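/- Let $\Delta>0$ and let $\nu$ be a finite (positive) Borel measure on $\mathbb R$ supported in $[-\Delta,\Delta]$, with Fourier transform $\widehat\nu(x)=\int_{\mathbb R} e^{-2\pi i x\alpha}\,d\nu(\alpha)$. Let $PW(\pi\Delta)$ be the set of entire functions $f:\mathbb C\to\mathbb C$ of exponential type at most $\pi\Delta$ (for every $\varepsilon>0$ there is $C_\varepsilon$ with $|f(z)|\le C_\varepsilon e^{(\pi\Delta+\varepsilon)|z|}$ for all $z\in\mathbb C$) such that $f|_{\mathbb R}\in L^2(\mathbb R)$. Let $\mathcal H_\nu$ be the set of entire functions $f$ of exponential type at most $\pi\Delta$ for which the integral $$\|f\|_\nu^2:=\int_{\mathbb R}|f(x)|^2\,\widehat\nu(x)\,dx$$ converges absolutely. Let $\mathcal A_\Delta$ be the class of continuous even functions $g:\mathbb R\to\mathbb R$ such that $g,\widehat g\in L^1(\mathbb R)$, $\widehat g(\alpha)\le 0$ for $\alpha\in\mathbb R\setminus[-\Delta,\Delta]$, and $g\ge 0$ on $\mathbb R$, where $\widehat g(\alpha)=\int_{\mathbb R}e^{-2\pi i\alpha x}g(x)\,dx$. Put $$\mathbf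 C_\nu:=\inf_{g\in\mathcal A_\Delta,\ g(0)>0}\ \frac1{g(0)}\int_{[-\Delta,\Delta]}\widehat g(\alpha)\,d\nu(\alpha),$$ the infimum being taken in the extended real numbers. Suppose that there are constants $a,b>0$ such that for every $f\in PW(\pi\Delta)$ the number $\|f\|_\nu^2$ is real and nonnegative and $$a\,\|f\|_{L^2(\mathbb R)}\le\|f\|_\nu\le b\,\|f\|_{L^2(\mathbb R)}.$$ Then $\mathcal H_\nu=PW(\pi\Delta)$ as sets. Moreover $\mathcal H_\nu$, with the inner product $\langle f,g\rangle_\nu=\int_{\mathbb R}f(x)\overline{g(x)}\,\widehat\nu(x)\,dx$ and the norm $\|\cdot\|_\nu$, is a reproducing kernel Hilbert space, that is, a Hilbert space of functions on $\mathbb C$ on which $f\mapsto f(w)$ is continuous for every $w\in\mathbb C$. Its reproducing kernel $K_\nu$, defined by $K_\nu(w,\cdot)\in\mathcal H_\nu$ and $f(w)=\langle f,K_\nu(w,\cdot)\rangle_\nu$ for all $f\in\mathcal H_\nu$ and $w\in\mathbb C$, satisfies $K_\nu(0,0)>0$ and $$\mathbf C_\nu\le\frac1{K_\nu(0,0)}.$$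 -/

import Mathlib

open MeasureTheory
open scoped FourierTransform ComplexConjugate

namespace PaleyWiener

/-- `f` is of exponential type at most `τ`: for every `ε > 0` there is a constant `C` with
`|f z| ≤ C * exp ((τ + ε) * |z|)` for all complex `z`. -/
def ExpTypeAtMost (τ : ℝ) (f : ℂ → ℂ) : Prop :=
  ∀ ε : ℝ, 0 < ε → ∃ C : ℝ, ∀ z : ℂ, ‖f z‖ ≤ C * Real.exp ((τ + ε) * ‖z‖)

/-- The Paley-Wiener space `PW(τ)`: entire functions of exponential type at most `τ` whose
restriction to the real line is square integrable. -/
def PW (τ : ℝ) : Set (ℂ → ℂ) :=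
  {f | Differentiable ℂ f ∧ ExpTypeAtMost τ f ∧ MemLp (fun x : ℝ => f x) 2 volume}

/-- The norm of `L²(ℝ)` of the restriction of `f` to the real line. -/
noncomputable def l2Norm (f : ℂ → ℂ) : ℝ :=
  √(∫ x : ℝ, ‖f x‖ ^ 2)

/-- The Fourier transform of a finite measure, `ξ ↦ ∫ exp (-2 π i ξ α) dν(α)`. -/
noncomputable def measureFourier (ν : Measure ℝ) (ξ : ℝ) : ℂ :=
  ∫ α : ℝ, Complex.exp (-2 * Real.pi * Complex.I * ξ * α) ∂ν

/-- The quantity `∫ |f(x)|² ν̂(x) dx`, which is a complex number for a general `ν`. -/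
noncomputable def nuNormSq (ν : Measure ℝ) (f : ℂ → ℂ) : ℂ :=
  ∫ x : ℝ, ((‖f x‖ ^ 2 : ℝ) : ℂ) * measureFourier ν x

/-- `‖f‖_ν`, meaningful when `nuNormSq ν f` is a nonnegative real number. -/
noncomputable def nuNorm (ν : Measure ℝ) (f : ℂ → ℂ) : ℝ :=
  √(nuNormSq ν f).re

/-- The sesquilinear form `⟨f, g⟩_ν = ∫ f(x) conj(g(x)) ν̂(x) dx`. -/
noncomputable def nuForm (ν : Measure ℝ) (f g : ℂ → ℂ) : ℂ :=
  ∫ x : ℝ, f x * conj (g x) * measureFourier ν x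

/-- The set `H_ν` of entire functions of exponential type at most `π Δ` for which the integral of
`|f|² ν̂` over the real line converges (absolutely). -/
def nuSpace (Δ : ℝ) (ν : Measure ℝ) : Set (ℂ → ℂ) :=
  {f | Differentiable ℂ f ∧ ExpTypeAtMost (Real.pi * Δ) f ∧
    Integrable (fun x : ℝ => ((‖f x‖ ^ 2 : ℝ) : ℂ) * measureFourier ν x) volume}

/-- The Fourier transform of a real function `g`. It is real-valued when `g` is even. -/
noncomputable def realFourier (g : ℝ → ℝ) (α : ℝ) : ℝ :=
  (𝓕 (fun x : ℝ => (g x : ℂ)) α).re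

/-- The class `A_Δ` of continuous even functions `g` with `g` and `ĝ` integrable, `ĝ ≤ 0` outside
`[-Δ, Δ]`, and `g ≥ 0`. -/
structure CohnElkiesClass (Δ : ℝ) (g : ℝ → ℝ) : Prop where
  continuous : Continuous g
  even : ∀ x : ℝ, g (-x) = g x
  integrable : Integrable g volume
  integrable_fourier : Integrable (𝓕 (fun x : ℝ => (g x : ℂ))) volume
  fourier_nonpos : ∀ α : ℝ, α ∉ Set.Icc (-Δ) Δ → realFourier g α ≤ 0
  nonneg : ∀ x : ℝ, 0 ≤ g x

/-- The functional `Φ_ν(g)`, the integral of `ĝ` over `[-Δ, Δ]` against `ν`. -/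
noncomputable def phi (Δ : ℝ) (ν : Measure ℝ) (g : ℝ → ℝ) : ℝ :=
  ∫ α in Set.Icc (-Δ) Δ, realFourier g α ∂ν

/-- The constant `C_ν`, the infimum of `Φ_ν(g) / g(0)` over all `g` in `A_Δ` with `g(0) > 0`,
taken in the extended reals. -/
noncomputable def extremalConst (Δ : ℝ) (ν : Measure ℝ) : EReal :=
  sInf {r : EReal | ∃ g : ℝ → ℝ, CohnElkiesClass Δ g ∧ 0 < g 0 ∧
    r = ((phi Δ ν g / g 0 : ℝ) : EReal)}

/-- The reproducing kernel `K(w, z)` of a reproducing kernel Hilbert space of complex-valued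
functions on `ℂ`: the value at `z` of the function `K(w, ·)` which represents evaluation at `w`. -/
noncomputable def reproducingKernel (H : Type*) [NormedAddCommGroup H] [InnerProductSpace ℂ H]
    [CompleteSpace H] [RKHS ℂ H ℂ ℂ] (w z : ℂ) : ℂ :=
  (RKHS.kerFun H w (1 : ℂ) : H) z

end PaleyWiener

/-!
The lower bound for `‖·‖_ν`, applied to all real translates of one fixed function of `PW(πΔ)`,
shows that the uniformly continuous function `|ν̂|` exceeds a fixed `δ` on a subinterval of fixed
length of every interval of some fixed length `L`. By a Logvinenko-Sereda argument (a two-constants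
estimate on discs of fixed size, combined with the Phragmén-Lindelöf principle), an entire function
`f` of exponential type for which `∫ |f|² |ν̂|` converges is then square integrable on the line,
which gives `H_ν = PW(πΔ)`. The form `⟨·, ·⟩_ν` is Hermitian on this space by polarization, and it
makes it a Hilbert space since the image of `PW(πΔ)` in `L²(ℝ)` is closed.

For `k = K_ν(0, ·)` the function `g(x) = |k(x)|² + |k(-x)|²` is even, and its Fourier transform
vanishes off `[-Δ, Δ]`: the entire function `k(z) conj (k(conj z))` has exponential type `2πΔ`, so
the contour of the Fourier integral may be shifted to infinity. Hence `g` is admissible, and since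
`∫ ĝ dν = ∫ g ν̂ = 2 ‖k‖_ν² = 2 K_ν(0, 0)` and `g(0) = 2 K_ν(0, 0)²`, the quotient in the definition
of `C_ν` is `1 / K_ν(0, 0)`.
-/

namespace PaleyWiener

section TwoConstants

variable {E : Type*} [NormedAddCommGroup E] [NormedSpace ℂ E]

theorem norm_cosh_le (w : ℂ) : ‖Complex.cosh w‖ ≤ Real.cosh w.re := by
  rw [Complex.cosh, norm_div, Complex.norm_two, Real.cosh_eq]
  gcongr
  calc ‖Complex.exp w + Complex.exp (-w)‖ ≤ ‖Complex.exp w‖ + ‖Complex.exp (-w)‖ :=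
        norm_add_le _ _
    _ = Real.exp w.re + Real.exp (-w.re) := by simp [Complex.norm_exp]

theorem norm_sq_le_mul_of_norm_le_on_strip {F : ℂ → E} (hF : Differentiable ℂ F) {a b T : ℝ}
    (hT : 0 < T) (ha : ∀ w, w.re = 0 → ‖F w‖ ≤ a)
    (hb : ∀ w : ℂ, 0 ≤ w.re → w.re ≤ 2 * T → ‖F w‖ ≤ b) : ‖F T‖ ^ 2 ≤ a * b := by
  have hthree := Complex.HadamardThreeLines.norm_le_interp_of_mem_verticalClosedStrip'
    (f := F) (z := T) (a := a) (b := b) (l := 0) (u := 2 * T) (by positivity)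
    (show (T : ℂ).re ∈ Set.Icc 0 (2 * T) from ⟨hT.le, by simpa using by linarith⟩)
    hF.diffContOnCl ⟨b, by rintro _ ⟨w, hw, rfl⟩; exact hb w hw.1 hw.2⟩ ha
    fun w hw => hb w (by rw [hw]; positivity) hw.le
  have hmid : ((T : ℂ).re - 0) / (2 * T - 0) = 1 / 2 := by
    rw [Complex.ofReal_re]
    field_simp
    simp
  have ha0 : 0 ≤ a := (norm_nonneg _).trans (ha 0 rfl)
  rw [hmid, show (1 : ℝ) - 1 / 2 = 1 / 2 by norm_num, ← Real.sqrt_eq_rpow, ← Real.sqrt_eq_rpow,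
    ← Real.sqrt_mul ha0] at hthree
  have hb0 : 0 ≤ b := (norm_nonneg _).trans (hb 0 le_rfl (by simpa using by positivity))
  exact (Real.le_sqrt (norm_nonneg _) (mul_nonneg ha0 hb0)).1 hthree

theorem norm_one_sq_le_mul_of_norm_le {g : ℂ → E} (hg : Differentiable ℂ g) {ε a b : ℝ}
    (hε : 0 < ε) (hε1 : ε < 1) (ha : ∀ t : ℝ, |t| ≤ ε → ‖g t‖ ≤ a)
    (hb : ∀ z, ‖z‖ ≤ 2 / ε → ‖g z‖ ≤ b) : ‖g 1‖ ^ 2 ≤ a * b := by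
  set T := Real.arcosh ε⁻¹
  have hT : 0 < T := Real.arcosh_pos ((one_lt_inv₀ hε).2 hε1)
  have hcosh : Real.cosh T = ε⁻¹ := Real.cosh_arcosh ((one_lt_inv₀ hε).2 hε1).le
  have hcosh_two : Real.cosh (2 * T) ≤ 2 * ε⁻¹ ^ 2 := by
    rw [Real.cosh_two_mul, ← hcosh]
    linarith [Real.cosh_sq T]
  have hone : (ε : ℂ) * Complex.cosh T = 1 := by
    rw [← Complex.ofReal_cosh, hcosh]
    exact_mod_cast mul_inv_cancel₀ hε.ne'
  have hmap := norm_sq_le_mul_of_norm_le_on_strip (F := fun w => g (ε * Complex.cosh w))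
    (a := a) (b := b) (by fun_prop) hT (fun w hw => ?_) fun w hw0 hw => ?_
  · rwa [hone] at hmap
  · have hcos : (ε : ℂ) * Complex.cosh w = ((ε * Real.cos w.im : ℝ) : ℂ) := by
      rw [← Complex.re_add_im w, hw, Complex.ofReal_zero, zero_add, Complex.cosh_mul_I]
      simp
    rw [hcos]
    refine ha _ ?_
    rw [abs_mul, abs_of_pos hε]
    exact mul_le_of_le_one_right hε.le (Real.abs_cos_le_one _)
  · refine hb _ ?_
    have hre : Real.cosh w.re ≤ Real.cosh (2 * T) :=
      Real.cosh_le_cosh.2 (by rwa [abs_of_nonneg hw0, abs_of_pos (by positivity)])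
    calc ‖(ε : ℂ) * Complex.cosh w‖ ≤ ε * (2 * ε⁻¹ ^ 2) := by
          rw [norm_mul, Complex.norm_real, Real.norm_of_nonneg hε.le]
          gcongr
          exact (norm_cosh_le w).trans (hre.trans hcosh_two)
      _ = 2 / ε := by field_simp

end TwoConstants

section LocalEstimate

variable {E : Type*} [NormedAddCommGroup E] [NormedSpace ℂ E] [CompleteSpace E]

theorem norm_le_two_mul_circleAverage_norm {f : ℂ → E} (hf : Differentiable ℂ f) {c w : ℂ}
    {R : ℝ} (hR : 0 < R) (hw : ‖w - c‖ ≤ R) :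
    ‖f w‖ ≤ 2 * Real.circleAverage (fun z => ‖f z‖) c (2 * R) := by
  have hdiv : ∀ θ : ℝ, ‖(circleMap c (2 * R) θ - c) / (circleMap c (2 * R) θ - w)‖ ≤ 2 := by
    intro θ
    have hc : ‖circleMap c (2 * R) θ - c‖ = 2 * R := by
      simp [abs_of_pos hR]
    have hwz : R ≤ ‖circleMap c (2 * R) θ - w‖ := by
      have := norm_sub_le_norm_sub_add_norm_sub (circleMap c (2 * R) θ) w c
      linarith
    rw [norm_div, hc, div_le_iff₀ (hR.trans_le hwz)]
    linarith
  rw [← hf.diffContOnCl.circleAverage_smul_div (c := c) (w := w) (R := 2 * R) (by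
    rw [abs_of_pos (by positivity), mem_ball_iff_norm]; linarith), Real.circleAverage_def,
    Real.circleAverage_def, norm_smul, Real.norm_of_nonneg (by positivity), smul_eq_mul,
    mul_left_comm, ← intervalIntegral.integral_const_mul]
  gcongr
  refine intervalIntegral.norm_integral_le_of_norm_le Real.two_pi_pos.le
    (.of_forall fun θ _ => ?_) (Continuous.intervalIntegrable ?_ _ _)
  · rw [norm_smul]
    gcongr
    exact hdiv θ
  · have hcont : Continuous f := hf.continuous
    fun_prop

theorem differentiable_intervalIntegral_comp_add_mul {h : ℂ → E} (hh : Differentiable ℂ h)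
    {p q : ℝ → ℂ} (hp : Continuous p) (hq : Continuous q) (a b : ℝ) :
    Differentiable ℂ fun z => ∫ u in a..b, h (p u + z * q u) := by
  intro z₀
  have hcont : Continuous h := hh.continuous
  have hcont' : Continuous (deriv h) := (hh.contDiff (n := 1)).continuous_deriv le_rfl
  have hK : IsCompact (Metric.closedBall z₀ 1 ×ˢ Set.uIcc a b) :=
    (isCompact_closedBall z₀ 1).prod isCompact_uIcc
  obtain ⟨M, hM⟩ := hK.bddAbove_image
    (f := fun y : ℂ × ℝ => ‖q y.2 • deriv h (p y.2 + y.1 * q y.2)‖) (by fun_prop)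
  refine (intervalIntegral.hasDerivAt_integral_of_dominated_loc_of_deriv_le
    (F := fun z u => h (p u + z * q u)) (F' := fun z u => q u • deriv h (p u + z * q u))
    (bound := fun _ => M) (Metric.closedBall_mem_nhds z₀ one_pos)
    (.of_forall fun z => Continuous.aestronglyMeasurable (by fun_prop))
    (Continuous.intervalIntegrable (by fun_prop) _ _)
    (Continuous.aestronglyMeasurable (by fun_prop))
    (.of_forall fun u hu z hz => hM ⟨(z, u), ⟨hz, Set.uIoc_subset_uIcc hu⟩, rfl⟩)
    intervalIntegrable_const (.of_forall fun u _ z _ => ?_)).2.differentiableAt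
  have hinner : HasDerivAt (fun z => p u + z * q u) (q u) z := by
    simpa using ((hasDerivAt_id z).mul_const (q u)).const_add (p u)
  exact (hh _).hasDerivAt.scomp z hinner

theorem intervalIntegral_comp_homothety_le {φ : ℝ → ℝ} (hφ : Continuous φ) (hφ0 : ∀ u, 0 ≤ φ u)
    {x y η L t : ℝ} (hη : 0 < η) (hxy : x ≤ y) (hyL : y + η ≤ x + L) (ht : |t| ≤ η / (4 * L)) :
    ∫ u in (y + η / 4)..(y + 3 * η / 4), φ (t * x + (1 - t) * u) ≤ 2 * ∫ u in y..(y + η), φ u := by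
  have hηL : η ≤ L := by linarith
  have hL : 0 < L := hη.trans_le hηL
  have htL : |t| * L ≤ η / 4 := (mul_le_mul_of_nonneg_right ht hL.le).trans_eq (by field_simp)
  have ht1 : |t| ≤ 1 / 4 := ht.trans (by rw [div_le_iff₀ (by positivity)]; linarith)
  have ht2 : 1 / 2 ≤ 1 - t := by linarith [le_abs_self t]
  have hdisp : ∀ u ∈ Set.Icc y (y + η), |t * x + (1 - t) * u - u| ≤ η / 4 := by
    intro u hu
    rw [show t * x + (1 - t) * u - u = -(t * (u - x)) by ring, abs_neg, abs_mul,
      abs_of_nonneg (by linarith [hu.1] : 0 ≤ u - x)]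
    exact (mul_le_mul_of_nonneg_left (by linarith [hu.2]) (abs_nonneg t)).trans htL
  have hleft := (abs_le.1 (hdisp (y + η / 4) ⟨by linarith, by linarith⟩)).1
  have hright := (abs_le.1 (hdisp (y + 3 * η / 4) ⟨by linarith, by linarith⟩)).2
  have : 0 ≤ ∫ u in y..(y + η), φ u :=
    intervalIntegral.integral_nonneg (by linarith) fun u _ => hφ0 u
  rw [intervalIntegral.integral_comp_add_mul _ (by linarith), smul_eq_mul]
  refine mul_le_mul ?_ ?_ ?_ zero_le_two
  · exact inv_le_of_inv_le₀ two_pos (by linarith)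
  · refine intervalIntegral.integral_mono_interval (by linarith) ?_ (by linarith)
      (.of_forall hφ0) (hφ.intervalIntegrable _ _)
    gcongr
    linarith
  · refine intervalIntegral.integral_nonneg ?_ fun u _ => hφ0 u
    gcongr
    linarith

theorem norm_homothety_le_circleAverage {h : ℂ → E} (hh : Differentiable ℂ h) {x u L ρ : ℝ}
    (hL : 0 < L) (hu : u ∈ Set.Icc x (x + L)) {z : ℂ} (hz : ‖z‖ ≤ ρ) :
    ‖h (u + z * (x - u))‖ ≤ 2 * Real.circleAverage (fun z => ‖h z‖) x (2 * ((1 + ρ) * L)) := by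
  have hρ : 0 ≤ ρ := (norm_nonneg z).trans hz
  refine norm_le_two_mul_circleAverage_norm hh (by positivity) ?_
  rw [show (u : ℂ) + z * (x - u) - x = (1 - z) * (u - x : ℝ) by push_cast; ring, norm_mul,
    Complex.norm_real, Real.norm_of_nonneg (by linarith [hu.1])]
  have hz1 : ‖1 - z‖ ≤ 1 + ρ := (norm_sub_le _ _).trans (by rw [norm_one]; gcongr)
  exact mul_le_mul hz1 (by linarith [hu.2]) (by linarith [hu.1]) (by positivity)

theorem norm_sq_le_intervalIntegral_mul_circleAverage {h : ℂ → E} (hh : Differentiable ℂ h)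
    {x y η L : ℝ} (hη : 0 < η) (hxy : x ≤ y) (hyL : y + η ≤ x + L) :
    ‖h x‖ ^ 2 ≤ 8 / η * (∫ u in y..(y + η), ‖h u‖) *
      Real.circleAverage (fun z => ‖h z‖) x (2 * ((1 + 8 * L / η) * L)) := by
  have hL : 0 < L := by linarith
  set R := (1 + 8 * L / η) * L
  have : 0 < R := by positivity
  set A := Real.circleAverage (fun z => ‖h z‖) x (2 * R)
  have hlen : y + 3 * η / 4 - (y + η / 4) = η / 2 := by ring
  have hyη : y + η / 4 ≤ y + 3 * η / 4 := by linarith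
  have hcont : Continuous h := hh.continuous
  have htwo := norm_one_sq_le_mul_of_norm_le (a := 2 * ∫ u in y..(y + η), ‖h u‖) (b := η * A)
    (g := fun z => ∫ u in (y + η / 4)..(y + 3 * η / 4), h ((u : ℂ) + z * (x - u : ℂ)))
    (differentiable_intervalIntegral_comp_add_mul hh (by fun_prop) (by fun_prop) _ _)
    (ε := η / (4 * L)) (by positivity) (by rw [div_lt_one (by positivity)]; linarith) ?_ ?_
  · simp only [one_mul, add_sub_cancel, intervalIntegral.integral_const, hlen, norm_smul,
      Real.norm_of_nonneg (half_pos hη).le, mul_pow] at htwo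
    calc ‖h x‖ ^ 2 = (2 / η) ^ 2 * ((η / 2) ^ 2 * ‖h x‖ ^ 2) := by field_simp
      _ ≤ (2 / η) ^ 2 * (2 * (∫ u in y..(y + η), ‖h u‖) * (η * A)) := by gcongr
      _ = 8 / η * (∫ u in y..(y + η), ‖h u‖) * A := by field_simp; ring
  · intro t ht
    have hreal : ∀ u : ℝ, (u : ℂ) + t * (x - u) = (t * x + (1 - t) * u : ℝ) := fun u => by
      push_cast
      ring
    refine (intervalIntegral.norm_integral_le_integral_norm hyη).trans ?_
    simp_rw [hreal]
    exact intervalIntegral_comp_homothety_le (φ := fun u => ‖h u‖) (by fun_prop)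
      (fun _ => norm_nonneg _) hη hxy hyL ht
  · intro z hz
    have hz' : ‖z‖ ≤ 8 * L / η := hz.trans_eq (by field_simp; norm_num)
    refine (intervalIntegral.norm_integral_le_of_norm_le_const fun u hu =>
      norm_homothety_le_circleAverage hh hL ?_ hz').trans_eq ?_
    · rw [Set.uIoc_of_le hyη] at hu
      exact ⟨by linarith [hu.1], by linarith [hu.2]⟩
    · rw [hlen, abs_of_pos (half_pos hη)]
      ring

end LocalEstimate

section PhragmenLindelof

variable {E : Type*} [NormedAddCommGroup E] [NormedSpace ℂ E] {F : ℂ → E} {C σ : ℝ}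

theorem norm_le_exp_on_quadrant (hF : Differentiable ℂ F)
    (hC : ∀ z, ‖F z‖ ≤ C * Real.exp (σ * ‖z‖)) {M s t : ℝ}
    (hre : ∀ x : ℝ, 0 ≤ x → ‖F x‖ ≤ M * Real.exp (s * x))
    (him : ∀ y : ℝ, 0 ≤ y → ‖F (y * Complex.I)‖ ≤ M * Real.exp (t * y)) {z : ℂ}
    (hz_re : 0 ≤ z.re) (hz_im : 0 ≤ z.im) : ‖F z‖ ≤ M * Real.exp (s * z.re + t * z.im) := by
  let G : ℂ → E := fun w => Complex.exp (-(s * w) + t * (Complex.I * w)) • F w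
  have hG : ∀ w : ℂ, ‖G w‖ = (Real.exp (s * w.re + t * w.im))⁻¹ * ‖F w‖ := fun w => by
    rw [norm_smul, Complex.norm_exp, ← Real.exp_neg]
    congr 2
    simp
    ring
  have hgrowth : ∀ w, ‖G w‖ ≤ C * Real.exp ((|s| + |t| + σ) * ‖w‖) := fun w => by
    have hs : -(s * w.re) ≤ |s| * ‖w‖ := (neg_le_abs _).trans <| by
      rw [abs_mul]
      gcongr
      exact Complex.abs_re_le_norm w
    have ht : -(t * w.im) ≤ |t| * ‖w‖ := (neg_le_abs _).trans <| by
      rw [abs_mul]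
      gcongr
      exact Complex.abs_im_le_norm w
    rw [hG, ← Real.exp_neg, add_mul, Real.exp_add, mul_left_comm]
    gcongr
    · linarith
    · exact hC w
  suffices ‖G z‖ ≤ M by rwa [hG, inv_mul_le_iff₀ (Real.exp_pos _), mul_comm] at this
  refine PhragmenLindelof.quadrant_I (Differentiable.diffContOnCl (by fun_prop))
    ⟨1, one_lt_two, |s| + |t| + σ, .of_bound C (.of_forall fun w => ?_)⟩
    (fun x hx => ?_) (fun y hy => ?_) hz_re hz_im
  · rw [Real.rpow_one, Real.norm_of_nonneg (Real.exp_pos _).le]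
    exact hgrowth w
  · rw [hG, inv_mul_le_iff₀ (Real.exp_pos _), mul_comm]
    simpa using hre x hx
  · rw [hG, inv_mul_le_iff₀ (Real.exp_pos _), mul_comm _ M]
    simpa using him y hy

theorem norm_le_exp_abs_re_add_abs_im (hF : Differentiable ℂ F)
    (hC : ∀ z, ‖F z‖ ≤ C * Real.exp (σ * ‖z‖)) {M s : ℝ} (hCM : C ≤ M)
    (hM : ∀ x : ℝ, ‖F x‖ ≤ M * Real.exp (s * |x|)) (z : ℂ) :
    ‖F z‖ ≤ M * Real.exp (s * |z.re| + σ * |z.im|) := by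
  wlog him : 0 ≤ z.im generalizing F z
  · simpa using this (hF.comp differentiable_neg) (fun w => by simpa using hC (-w))
      (fun x => by simpa using hM (-x)) (-z) (by simpa using (not_le.1 him).le)
  have hI : ∀ y : ℝ, 0 ≤ y → ‖F (y * Complex.I)‖ ≤ M * Real.exp (σ * y) := fun y hy =>
    (hC _).trans (by simpa [abs_of_nonneg hy] using by gcongr)
  rw [abs_of_nonneg him]
  rcases le_total 0 z.re with hre | hre
  · rw [abs_of_nonneg hre]
    exact norm_le_exp_on_quadrant hF hC (fun x hx => by simpa [abs_of_nonneg hx] using hM x)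
      hI hre him
  · have hrot := norm_le_exp_on_quadrant (F := fun w => F (w * Complex.I)) (z := -Complex.I * z)
      (by fun_prop) (fun w => by simpa using hC (w * Complex.I)) hI
      (fun y hy => by simpa [mul_assoc, abs_of_nonneg hy] using hM (-y))
      (by simpa using him) (by simpa using hre)
    have hz : -(Complex.I * z * Complex.I) = z := by
      rw [mul_right_comm]; simp
    rw [abs_of_nonpos hre, add_comm]
    simpa [hz] using hrot

theorem norm_le_mul_exp_abs_im (hF : Differentiable ℂ F)
    (hC : ∀ z, ‖F z‖ ≤ C * Real.exp (σ * ‖z‖)) {S : ℝ} (hS : ∀ x : ℝ, ‖F x‖ ≤ S) (z : ℂ) :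
    ‖F z‖ ≤ S * Real.exp (σ * |z.im|) := by
  wlog him : 0 ≤ z.im generalizing F z
  · simpa using this (hF.comp differentiable_neg) (fun w => by simpa using hC (-w))
      (fun x => by simpa using hS (-x)) (-z) (by simpa using (not_le.1 him).le)
  let G : ℂ → E := fun w => Complex.exp (-(σ * w)) • F (w * Complex.I)
  have hG : ∀ w : ℂ, ‖G w‖ = (Real.exp (σ * w.re))⁻¹ * ‖F (w * Complex.I)‖ := fun w => by
    simp [G, norm_smul, Complex.norm_exp, Real.exp_neg]
  have hgrowth : ∀ w, ‖G w‖ ≤ C * Real.exp ((|σ| + σ) * ‖w‖) := fun w => by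
    rw [hG, ← Real.exp_neg, add_mul, Real.exp_add, mul_left_comm]
    gcongr
    · refine (neg_le_abs _).trans ?_
      rw [abs_mul]
      gcongr
      exact Complex.abs_re_le_norm w
    · simpa using hC (w * Complex.I)
  have hz : -Complex.I * z * Complex.I = z := by
    rw [mul_right_comm]; simp
  suffices ‖G (-Complex.I * z)‖ ≤ S by
    rw [hG, inv_mul_le_iff₀ (Real.exp_pos _), hz, mul_comm] at this
    simpa [abs_of_nonneg him] using this
  refine PhragmenLindelof.right_half_plane_of_bounded_on_real
    (Differentiable.diffContOnCl (by fun_prop))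
    ⟨1, one_lt_two, |σ| + σ, .of_bound C (.of_forall fun w => ?_)⟩
    ⟨C, Filter.eventually_map.2 ?_⟩ (fun y => ?_) (by simpa using him)
  · rw [Real.rpow_one, Real.norm_of_nonneg (Real.exp_pos _).le]
    exact hgrowth w
  · filter_upwards [Filter.eventually_ge_atTop 0] with x hx
    rw [hG, inv_mul_le_iff₀ (Real.exp_pos _), mul_comm _ C]
    simpa [abs_of_nonneg hx] using hC (x * Complex.I)
  · rw [hG]
    simpa [mul_assoc] using hS (-y)

theorem norm_real_le_exp_half (hF : Differentiable ℂ F)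
    (hC : ∀ z, ‖F z‖ ≤ C * Real.exp (σ * ‖z‖)) {B R : ℝ} (hB : 0 ≤ B) (hR : 0 ≤ R)
    (h : ∀ x d : ℝ, (∀ z ∈ Metric.closedBall (x : ℂ) R, ‖F z‖ ≤ d) → ‖F x‖ ^ 2 ≤ B * d) {M s : ℝ}
    (hCM : C ≤ M) (hBM : B * Real.exp (2 * σ * R) ≤ M) (hs : 0 ≤ s) (hsσ : s ≤ σ)
    (hM : ∀ x : ℝ, ‖F x‖ ≤ M * Real.exp (s * |x|)) (x : ℝ) :
    ‖F x‖ ≤ M * Real.exp (s / 2 * |x|) := by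
  have hM0 : 0 ≤ M := (by positivity : 0 ≤ B * Real.exp (2 * σ * R)).trans hBM
  have hσ : 0 ≤ σ := hs.trans hsσ
  have hball : ∀ z ∈ Metric.closedBall (x : ℂ) R, ‖F z‖ ≤ M * Real.exp (s * |x| + 2 * σ * R) := by
    intro z hz
    rw [mem_closedBall_iff_norm] at hz
    have hre : |z.re| ≤ |x| + R := by
      have := (Complex.abs_re_le_norm (z - x)).trans hz
      rw [Complex.sub_re, Complex.ofReal_re] at this
      linarith [abs_sub_abs_le_abs_sub z.re x]
    have him : |z.im| ≤ R := by simpa using (Complex.abs_im_le_norm (z - x)).trans hz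
    refine (norm_le_exp_abs_re_add_abs_im hF hC hCM hM z).trans ?_
    refine mul_le_mul_of_nonneg_left (Real.exp_le_exp.2 ?_) hM0
    calc s * |z.re| + σ * |z.im| ≤ s * (|x| + R) + σ * R := by gcongr
      _ ≤ s * |x| + 2 * σ * R := by linarith [mul_le_mul_of_nonneg_right hsσ hR]
  refine le_of_sq_le_sq ?_ (by positivity)
  calc ‖F x‖ ^ 2 ≤ B * (M * Real.exp (s * |x| + 2 * σ * R)) := h x _ hball
    _ = B * Real.exp (2 * σ * R) * M * Real.exp (s * |x|) := by rw [Real.exp_add]; ring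
    _ ≤ M * M * Real.exp (s * |x|) := by gcongr
    _ = (M * Real.exp (s / 2 * |x|)) ^ 2 := by
      rw [mul_pow, ← Real.exp_nat_mul, sq M]
      congr 2
      push_cast
      ring

theorem norm_real_le_of_norm_sq_le_mul_bound (hF : Differentiable ℂ F)
    (hC : ∀ z, ‖F z‖ ≤ C * Real.exp (σ * ‖z‖)) (hσ : 0 ≤ σ) {B R : ℝ} (hB : 0 ≤ B) (hR : 0 ≤ R)
    (h : ∀ x d : ℝ, (∀ z ∈ Metric.closedBall (x : ℂ) R, ‖F z‖ ≤ d) → ‖F x‖ ^ 2 ≤ B * d) (x : ℝ) :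
    ‖F x‖ ≤ max C (B * Real.exp (2 * σ * R)) := by
  set M := max C (B * Real.exp (2 * σ * R))
  have hCM : C ≤ M := le_max_left _ _
  have hhalving : ∀ m : ℕ, ∀ x : ℝ, ‖F x‖ ≤ M * Real.exp (σ / 2 ^ m * |x|) := by
    intro m
    induction m with
    | zero => exact fun x => (hC x).trans (by simpa using by gcongr)
    | succ m ih =>
      rw [pow_succ, ← div_div]
      exact norm_real_le_exp_half hF hC hB hR h hCM (le_max_right _ _) (by positivity)
        (div_le_self hσ (one_le_pow₀ one_le_two)) ih
  refine ge_of_tendsto' (x := Filter.atTop) ?_ fun m => hhalving m x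
  have hpow := tendsto_const_nhds (x := σ).div_atTop
    (tendsto_pow_atTop_atTop_of_one_lt (one_lt_two (α := ℝ)))
  simpa using ((hpow.mul_const |x|).rexp).const_mul M

theorem norm_le_of_norm_sq_le_mul_bound (hF : Differentiable ℂ F)
    (hC : ∀ z, ‖F z‖ ≤ C * Real.exp (σ * ‖z‖)) (hσ : 0 ≤ σ) {B R : ℝ} (hB : 0 ≤ B) (hR : 0 ≤ R)
    (h : ∀ x d : ℝ, (∀ z ∈ Metric.closedBall (x : ℂ) R, ‖F z‖ ≤ d) → ‖F x‖ ^ 2 ≤ B * d) (z : ℂ) :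
    ‖F z‖ ≤ B * Real.exp (σ * R) * Real.exp (σ * |z.im|) := by
  have hbdd : BddAbove (Set.range fun x : ℝ => ‖F x‖) :=
    ⟨_, Set.forall_mem_range.2 (norm_real_le_of_norm_sq_le_mul_bound hF hC hσ hB hR h)⟩
  set S := ⨆ x : ℝ, ‖F x‖
  have hFS : ∀ x : ℝ, ‖F x‖ ≤ S := le_ciSup hbdd
  have hS0 : 0 ≤ S := (norm_nonneg _).trans (hFS 0)
  have hball : ∀ x : ℝ, ‖F x‖ ≤ √(B * Real.exp (σ * R) * S) := fun x => by
    refine Real.le_sqrt_of_sq_le ((h x (S * Real.exp (σ * R)) fun w hw => ?_).trans_eq (by ring))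
    rw [mem_closedBall_iff_norm] at hw
    have him : |w.im| ≤ R := by simpa using (Complex.abs_im_le_norm (w - x)).trans hw
    exact (norm_le_mul_exp_abs_im hF hC hFS w).trans (by gcongr)
  have hSle : S ≤ B * Real.exp (σ * R) := by
    have hsq := (Real.le_sqrt hS0 (by positivity)).1 (ciSup_le hball)
    by_contra! hlt
    nlinarith [(by positivity : 0 ≤ B * Real.exp (σ * R))]
  exact norm_le_mul_exp_abs_im hF hC (fun x => (hFS x).trans hSle) z

end PhragmenLindelof

section LogvinenkoSereda

/-- A nonnegative weight on `ℝ` that is at least `δ` on a subinterval of length `η` of every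
interval of length `L`. These are the weights of the Logvinenko-Sereda theorem, with the large set
taken to be a union of intervals. -/
structure IsThickWeight (L η δ : ℝ) (m : ℝ → ℝ) : Prop where
  length_pos : 0 < η
  level_pos : 0 < δ
  nonneg : ∀ x, 0 ≤ m x
  exists_interval : ∀ x, ∃ y, x ≤ y ∧ y + η ≤ x + L ∧ ∀ u ∈ Set.Icc y (y + η), δ ≤ m u

theorem isThickWeight_one : IsThickWeight 1 1 1 1 where
  length_pos := one_pos
  level_pos := one_pos
  nonneg _ := zero_le_one
  exists_interval x := ⟨x, le_rfl, le_rfl, fun _ _ => le_rfl⟩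

theorem IsThickWeight.length_le {L η δ : ℝ} {m : ℝ → ℝ} (hm : IsThickWeight L η δ m) : η ≤ L := by
  obtain ⟨y, h0y, hyL, -⟩ := hm.exists_interval 0
  linarith

theorem sum_norm_sq_le_sqrt_mul_sqrt {ι : Type*} {s : Finset ι} {f : ι → ℂ → ℂ}
    (hf : ∀ i, Differentiable ℂ (f i)) {x η L A D : ℝ} (hη : 0 < η) (hL : 0 < L) {y : ι → ℝ}
    (hxy : ∀ i, x ≤ y i) (hyL : ∀ i, y i + η ≤ x + L)
    (hA : ∑ i ∈ s, ∫ u in (y i)..(y i + η), ‖f i u‖ ^ 2 ≤ A)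
    (hD : ∀ z ∈ Metric.closedBall (x : ℂ) (2 * ((1 + 8 * L / η) * L)), ∑ i ∈ s, ‖f i z‖ ^ 2 ≤ D) :
    ∑ i ∈ s, ‖f i x‖ ^ 2 ≤ √(8 / η * A) * √D := by
  set R := 2 * ((1 + 8 * L / η) * L)
  have hR : 0 < R := by positivity
  set I : ι → ℝ := fun i => ∫ u in (y i)..(y i + η), ‖f i u‖ ^ 2
  set V : ι → ℝ := fun i => Real.circleAverage (fun z => ‖f i z‖ ^ 2) x R
  have hI0 : ∀ i, 0 ≤ 8 / η * I i := fun i =>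
    mul_nonneg (by positivity)
      (intervalIntegral.integral_nonneg (by linarith) fun _ _ => sq_nonneg _)
  have hV0 : ∀ i, 0 ≤ V i := fun i => Real.circleAverage_nonneg_of_nonneg fun _ _ => sq_nonneg _
  have hterm : ∀ i, ‖f i x‖ ^ 2 ≤ √(8 / η * I i) * √(V i) := fun i => by
    rw [← Real.sqrt_mul (hI0 i)]
    refine Real.le_sqrt_of_sq_le ?_
    have hsq := norm_sq_le_intervalIntegral_mul_circleAverage
      (h := fun z => f i z ^ 2) ((hf i).pow 2) hη (hxy i) (hyL i)
    simp only [norm_pow] at hsq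
    exact hsq
  have hcirc : ∀ i, CircleIntegrable (fun z => ‖f i z‖ ^ 2) x R := fun i =>
    ((hf i).continuous.norm.pow 2).continuousOn.circleIntegrable'
  have hsumV : ∑ i ∈ s, V i ≤ D := by
    rw [← Real.circleAverage_fun_sum fun i _ => hcirc i]
    refine Real.circleAverage_mono_on_of_le_circle (CircleIntegrable.fun_sum s fun i _ => hcirc i)
      fun z hz => hD z ?_
    rw [abs_of_pos hR] at hz
    exact Metric.sphere_subset_closedBall hz
  calc ∑ i ∈ s, ‖f i x‖ ^ 2 ≤ ∑ i ∈ s, √(8 / η * I i) * √(V i) :=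
        Finset.sum_le_sum fun i _ => hterm i
    _ ≤ √(∑ i ∈ s, 8 / η * I i) * √(∑ i ∈ s, V i) :=
        Real.sum_sqrt_mul_sqrt_le s hI0 hV0
    _ ≤ √(8 / η * A) * √D := by
        rw [← Finset.mul_sum]
        gcongr

theorem sum_intervalIntegral_le_of_le_weight {g m : ℝ → ℝ} (hg : Continuous g)
    (hg0 : ∀ u, 0 ≤ g u) (hm0 : ∀ u, 0 ≤ m u) (hgm : Integrable fun u => g u * m u)
    {x L η δ : ℝ} (hη : 0 < η) (hδ : 0 < δ) {y : ℤ → ℝ} (hxy : ∀ k, x + k * L ≤ y k)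
    (hyL : ∀ k, y k + η ≤ x + k * L + L) (hδm : ∀ k, ∀ u ∈ Set.Icc (y k) (y k + η), δ ≤ m u)
    (s : Finset ℤ) :
    ∑ k ∈ s, ∫ u in (y k)..(y k + η), g u ≤ δ⁻¹ * ∫ u, g u * m u := by
  have hgm0 : 0 ≤ fun u => g u * m u := fun u => mul_nonneg (hg0 u) (hm0 u)
  have hlocal : ∀ k, ∫ u in (y k)..(y k + η), g u ≤
      δ⁻¹ * ∫ u in Set.Ioc (x + k • L) (x + (k + 1) • L), g u * m u := by
    intro k
    calc ∫ u in (y k)..(y k + η), g u ≤ ∫ u in Set.Ioc (y k) (y k + η), δ⁻¹ * (g u * m u) := by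
          rw [intervalIntegral.integral_of_le (by linarith)]
          refine setIntegral_mono_on hg.integrableOn_Ioc (hgm.const_mul _).integrableOn
            measurableSet_Ioc fun u hu => ?_
          have := hδm k u (Set.Ioc_subset_Icc_self hu)
          rw [inv_mul_eq_div, le_div_iff₀ hδ]
          gcongr
          exact hg0 u
      _ ≤ _ := by
          rw [integral_const_mul]
          refine mul_le_mul_of_nonneg_left ?_ (inv_nonneg.2 hδ.le)
          refine setIntegral_mono_set hgm.integrableOn (ae_of_all _ hgm0)
            (Set.Ioc_subset_Ioc ?_ ?_).eventuallyLE
          · simpa using hxy k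
          · simpa [add_mul, add_assoc] using hyL k
  calc _ ≤ _ := Finset.sum_le_sum fun k _ => hlocal k
    _ = δ⁻¹ * ∫ u in ⋃ k ∈ s, Set.Ioc (x + k • L) (x + (k + 1) • L), g u * m u := by
        rw [← Finset.mul_sum, integral_biUnion_finset s (fun _ _ => measurableSet_Ioc)
          ((Set.pairwise_disjoint_Ioc_add_zsmul x L).set_pairwise _) fun _ _ => hgm.integrableOn]
    _ ≤ _ := by
        exact mul_le_mul_of_nonneg_left (setIntegral_le_integral hgm (ae_of_all _ hgm0))
          (inv_nonneg.2 hδ.le)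

theorem exists_norm_translates_le_exp {f : ℂ → ℂ} {C σ : ℝ} (hσ : 0 ≤ σ)
    (hC : ∀ z, ‖f z‖ ≤ C * Real.exp (σ * ‖z‖)) (L : ℝ) (s : Finset ℤ) :
    ∃ C' : ℝ, ∀ z, ‖WithLp.toLp 2 fun k : s => f (z + k * L)‖ ≤ C' * Real.exp (σ * ‖z‖) := by
  have hC0 : 0 ≤ C := by simpa using (norm_nonneg _).trans (hC 0)
  refine ⟨√(∑ k : s, (C * Real.exp (σ * ‖((k : ℤ) * L : ℂ)‖)) ^ 2), fun z => ?_⟩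
  rw [EuclideanSpace.norm_eq]
  refine Real.sqrt_le_iff.2 ⟨by positivity, ?_⟩
  rw [mul_pow, Real.sq_sqrt (by positivity), Finset.sum_mul]
  refine Finset.sum_le_sum fun k _ => ?_
  rw [← mul_pow, mul_assoc, ← Real.exp_add, ← mul_add]
  refine pow_le_pow_left₀ (norm_nonneg _) ((hC _).trans ?_) 2
  gcongr
  rw [add_comm]
  exact norm_add_le _ _

theorem IsThickWeight.sum_norm_sq_real_le {L η δ : ℝ} {m : ℝ → ℝ} (hm : IsThickWeight L η δ m)
    {f : ℂ → ℂ} (hf : Differentiable ℂ f) (hfm : Integrable fun x : ℝ => ‖f x‖ ^ 2 * m x)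
    {s : Finset ℤ} {x D : ℝ}
    (hD : ∀ z ∈ Metric.closedBall (x : ℂ) (2 * ((1 + 8 * L / η) * L)),
      ∑ k ∈ s, ‖f (z + k * L)‖ ^ 2 ≤ D) :
    ∑ k ∈ s, ‖f (x + k * L)‖ ^ 2 ≤ √(8 / η * (δ⁻¹ * ∫ u : ℝ, ‖f u‖ ^ 2 * m u)) * √D := by
  have hη := hm.length_pos
  choose y hxy hyL hym using fun k : ℤ => hm.exists_interval (x + k * L)
  have hcont : Continuous fun u : ℝ => ‖f u‖ ^ 2 :=
    (hf.continuous.comp Complex.continuous_ofReal).norm.pow 2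
  have hshift : ∀ k : ℤ, ∫ u in (y k - k * L)..(y k - k * L + η), ‖f (u + k * L)‖ ^ 2 =
      ∫ u in (y k)..(y k + η), ‖f u‖ ^ 2 := fun k => by
    have := intervalIntegral.integral_comp_add_right (a := y k - k * L) (b := y k - k * L + η)
      (fun u : ℝ => ‖f u‖ ^ 2) (k * L)
    push_cast at this
    rw [this]
    ring_nf
  refine sum_norm_sq_le_sqrt_mul_sqrt (f := fun (k : ℤ) z => f (z + k * L))
    (fun k => hf.comp (differentiable_id.add_const _)) hη (hη.trans_le hm.length_le)
    (y := fun k => y k - k * L) (fun k => by linarith [hxy k])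
    (fun k => by linarith [hyL k]) ?_ hD
  simp only [hshift]
  exact sum_intervalIntegral_le_of_le_weight hcont (fun _ => sq_nonneg _) hm.nonneg hfm hη
    hm.level_pos hxy hyL hym s

theorem IsThickWeight.exists_sum_norm_sq_le {L η δ σ : ℝ} {m : ℝ → ℝ} (hm : IsThickWeight L η δ m)
    (hσ : 0 ≤ σ) : ∃ B : ℝ, 0 ≤ B ∧ ∀ (f : ℂ → ℂ) (C : ℝ), Differentiable ℂ f →
      (∀ z, ‖f z‖ ≤ C * Real.exp (σ * ‖z‖)) → Integrable (fun x : ℝ => ‖f x‖ ^ 2 * m x) →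
      ∀ (s : Finset ℤ) (z : ℂ), ∑ k ∈ s, ‖f (z + k * L)‖ ^ 2 ≤
        B * (∫ x : ℝ, ‖f x‖ ^ 2 * m x) * Real.exp (2 * σ * |z.im|) := by
  have hη := hm.length_pos
  have hδ := hm.level_pos
  have hL := hη.trans_le hm.length_le
  set R := 2 * ((1 + 8 * L / η) * L)
  refine ⟨8 / η * δ⁻¹ * Real.exp (2 * σ * R), by positivity, fun f C hf hC hfm s z => ?_⟩
  set I := ∫ x : ℝ, ‖f x‖ ^ 2 * m x
  have hI : 0 ≤ I := integral_nonneg fun x => mul_nonneg (sq_nonneg _) (hm.nonneg x)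
  let F : ℂ → EuclideanSpace ℂ s := fun z => WithLp.toLp 2 fun k => f (z + k * L)
  have hF : Differentiable ℂ F :=
    differentiable_euclidean.2 fun k => hf.comp (differentiable_id.add_const _)
  have hF_sq : ∀ z, ‖F z‖ ^ 2 = ∑ k ∈ s, ‖f (z + k * L)‖ ^ 2 := fun z => by
    rw [EuclideanSpace.norm_sq_eq, ← Finset.sum_coe_sort s]
  obtain ⟨C', hC'⟩ := exists_norm_translates_le_exp hσ hC L s
  have hF_le := norm_le_of_norm_sq_le_mul_bound hF hC' hσ (R := R) (B := √(8 / η * (δ⁻¹ * I)))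
    (Real.sqrt_nonneg _) (by positivity) (fun x d hd => ?_) z
  · rw [← hF_sq]
    calc ‖F z‖ ^ 2
        ≤ (√(8 / η * (δ⁻¹ * I)) * Real.exp (σ * R) * Real.exp (σ * |z.im|)) ^ 2 := by gcongr
      _ = _ := by
        rw [mul_pow, mul_pow, Real.sq_sqrt (by positivity), ← Real.exp_nat_mul,
          ← Real.exp_nat_mul]
        push_cast
        ring_nf
  · have hd0 : 0 ≤ d := (norm_nonneg _).trans (hd x (Metric.mem_closedBall_self (by positivity)))
    rw [hF_sq, ← Real.sqrt_sq hd0]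
    refine hm.sum_norm_sq_real_le hf hfm fun w hw => ?_
    rw [← hF_sq]
    exact pow_le_pow_left₀ (norm_nonneg _) (hd w hw) 2

theorem integrable_and_integral_le_of_sum_translates_le {g : ℝ → ℝ} (hg : Continuous g)
    (hg0 : ∀ x, 0 ≤ g x) {L D : ℝ} (hL : 0 < L)
    (h : ∀ (s : Finset ℤ) (x : ℝ), ∑ k ∈ s, g (x + k * L) ≤ D) :
    Integrable g ∧ ∫ x, g x ≤ L * D := by
  let I : ℤ → Set ℝ := fun k => Set.Ioc (0 + k • L) (0 + (k + 1) • L)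
  have hI : ⋃ k, I k = Set.univ := iUnion_Ioc_add_zsmul hL 0
  have hshift : ∀ k, ∫ x in I k, g x = ∫ x in 0..L, g (x + k * L) := fun k => by
    rw [intervalIntegral.integral_comp_add_right, intervalIntegral.integral_of_le (by linarith)]
    simp [I, add_mul, add_comm]
  have hsum : ∀ s : Finset ℤ, ∑ k ∈ s, ∫ x in I k, g x ≤ L * D := fun s => by
    have hcont : ∀ k : ℤ, Continuous fun x => g (x + k * L) := fun k => by fun_prop
    simp only [hshift]
    rw [← intervalIntegral.integral_finsetSum fun k _ => (hcont k).intervalIntegrable _ _]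
    calc ∫ x in 0..L, ∑ k ∈ s, g (x + k * L) ≤ ∫ _ in 0..L, D :=
          intervalIntegral.integral_mono_on hL.le
            ((continuous_finsetSum s fun k _ => hcont k).intervalIntegrable _ _)
            intervalIntegrable_const fun x _ => h s x
      _ = L * D := by simp
  have hpos : ∀ k, 0 ≤ ∫ x in I k, g x := fun k => integral_nonneg hg0
  have hgI : IntegrableOn g (⋃ k, I k) :=
    integrableOn_iUnion_of_summable_integral_norm
      (fun _ => hg.integrableOn_Ioc) (by
        simpa only [Real.norm_of_nonneg (hg0 _)] using summable_of_sum_le hpos hsum)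
  have hasSum := hasSum_integral_iUnion (fun _ => measurableSet_Ioc)
    (Set.pairwise_disjoint_Ioc_add_zsmul 0 L) hgI
  rw [hI, integrableOn_univ] at hgI
  rw [hI, setIntegral_univ] at hasSum
  exact ⟨hgI, hasSum_le_of_sum_le hasSum hsum⟩

theorem IsThickWeight.integrable_norm_sq {L η δ σ C : ℝ} {m : ℝ → ℝ} (hm : IsThickWeight L η δ m)
    (hσ : 0 ≤ σ) {f : ℂ → ℂ} (hf : Differentiable ℂ f)
    (hC : ∀ z, ‖f z‖ ≤ C * Real.exp (σ * ‖z‖)) (hfm : Integrable fun x : ℝ => ‖f x‖ ^ 2 * m x) :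
    Integrable fun x : ℝ => ‖f x‖ ^ 2 := by
  obtain ⟨B, -, hB⟩ := hm.exists_sum_norm_sq_le hσ
  exact (integrable_and_integral_le_of_sum_translates_le
    ((hf.continuous.comp Complex.continuous_ofReal).norm.pow 2) (fun _ => sq_nonneg _)
    (hm.length_pos.trans_le hm.length_le) fun s x => by simpa using hB f C hf hC hfm s x).1

end LogvinenkoSereda

section PaleyWienerSpace

variable {τ σ : ℝ} {f : ℂ → ℂ}

theorem ExpTypeAtMost.exists_le (hf : ExpTypeAtMost τ f) (hσ : τ < σ) :
    ∃ C : ℝ, ∀ z, ‖f z‖ ≤ C * Real.exp (σ * ‖z‖) := by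
  simpa using hf (σ - τ) (sub_pos.2 hσ)

theorem ExpTypeAtMost.add {g : ℂ → ℂ} (hf : ExpTypeAtMost τ f) (hg : ExpTypeAtMost τ g) :
    ExpTypeAtMost τ (f + g) := by
  intro ε hε
  obtain ⟨C, hC⟩ := hf ε hε
  obtain ⟨D, hD⟩ := hg ε hε
  refine ⟨C + D, fun z => (norm_add_le _ _).trans ?_⟩
  rw [add_mul]
  exact add_le_add (hC z) (hD z)

theorem ExpTypeAtMost.const_smul (hf : ExpTypeAtMost τ f) (c : ℂ) : ExpTypeAtMost τ (c • f) := by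
  intro ε hε
  obtain ⟨C, hC⟩ := hf ε hε
  refine ⟨‖c‖ * C, fun z => ?_⟩
  rw [Pi.smul_apply, norm_smul, mul_assoc]
  gcongr
  exact hC z

theorem ExpTypeAtMost.comp_add_const (hτ : 0 ≤ τ) (hf : ExpTypeAtMost τ f) (w : ℂ) :
    ExpTypeAtMost τ fun z => f (z + w) := by
  intro ε hε
  obtain ⟨C, hC⟩ := hf ε hε
  have hC0 : 0 ≤ C := by simpa using (norm_nonneg _).trans (hC 0)
  refine ⟨C * Real.exp ((τ + ε) * ‖w‖), fun z => (hC _).trans ?_⟩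
  rw [mul_assoc, ← Real.exp_add, ← mul_add]
  gcongr
  exact (norm_add_le z w).trans_eq (add_comm _ _)

theorem integrable_norm_sq_of_mem_PW (hf : f ∈ PW τ) : Integrable fun x : ℝ => ‖f x‖ ^ 2 :=
  (memLp_two_iff_integrable_sq_norm hf.2.2.aestronglyMeasurable).1 hf.2.2

theorem mem_PW_of_integrable_norm_sq (hf : Differentiable ℂ f) (hτ : ExpTypeAtMost τ f)
    (hint : Integrable fun x : ℝ => ‖f x‖ ^ 2) : f ∈ PW τ :=
  ⟨hf, hτ, (memLp_two_iff_integrable_sq_norm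
    (hf.continuous.comp Complex.continuous_ofReal).aestronglyMeasurable).2 hint⟩

theorem comp_add_const_mem_PW (hτ : 0 ≤ τ) (hf : f ∈ PW τ) (t : ℝ) :
    (fun z => f (z + t)) ∈ PW τ := by
  refine ⟨hf.1.comp (differentiable_id.add_const _), hf.2.1.comp_add_const hτ t, ?_⟩
  simpa [Function.comp_def] using
    hf.2.2.comp_measurePreserving (measurePreserving_add_right volume t)

theorem exists_sum_norm_sq_le_of_mem_PW (hσ : 0 ≤ σ) (hτ : τ < σ) :
    ∃ B : ℝ, 0 ≤ B ∧ ∀ f ∈ PW τ, ∀ (s : Finset ℤ) (z : ℂ),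
      ∑ k ∈ s, ‖f (z + k)‖ ^ 2 ≤ B * (∫ x : ℝ, ‖f x‖ ^ 2) * Real.exp (2 * σ * |z.im|) := by
  obtain ⟨B, hB0, hB⟩ := isThickWeight_one.exists_sum_norm_sq_le hσ
  refine ⟨B, hB0, fun f hf s z => ?_⟩
  obtain ⟨C, hC⟩ := hf.2.1.exists_le hτ
  simpa using hB f C hf.1 hC (by simpa using integrable_norm_sq_of_mem_PW hf) s z

/-- The Paley-Wiener space as a complex vector space. -/
def PWSubmodule (τ : ℝ) : Submodule ℂ (ℂ → ℂ) where
  carrier := PW τ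
  add_mem' hf hg := ⟨hf.1.add hg.1, hf.2.1.add hg.2.1, hf.2.2.add hg.2.2⟩
  zero_mem' := ⟨differentiable_const 0, fun _ _ => ⟨0, fun z => by simp⟩, MemLp.zero⟩
  smul_mem' c _ hf := ⟨hf.1.const_smul c, hf.2.1.const_smul c, hf.2.2.const_smul c⟩

/-- Restriction to the real line, as a linear map from the Paley-Wiener space to `L²(ℝ)`. -/
noncomputable def toL2 (τ : ℝ) : PWSubmodule τ →ₗ[ℂ] Lp ℂ 2 (volume : Measure ℝ) where
  toFun f := f.2.2.2.toLp
  map_add' f g := f.2.2.2.toLp_add g.2.2.2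
  map_smul' c f := f.2.2.2.toLp_const_smul c

theorem norm_toL2 (f : PWSubmodule τ) : ‖toL2 τ f‖ = l2Norm f := by
  change ‖f.2.2.2.toLp‖ = _
  rw [Lp.norm_toLp, f.2.2.2.eLpNorm_eq_integral_rpow_norm (by simp) (by simp),
    ENNReal.toReal_ofReal (by positivity), l2Norm, Real.sqrt_eq_rpow]
  simp

theorem exists_norm_apply_le_mul_norm_toL2 (hσ : 0 ≤ σ) (hτ : τ < σ) :
    ∃ B : ℝ, 0 ≤ B ∧ ∀ (f : PWSubmodule τ) (z : ℂ),
      ‖(f : ℂ → ℂ) z‖ ≤ B * ‖toL2 τ f‖ * Real.exp (σ * |z.im|) := by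
  obtain ⟨B, hB0, hB⟩ := exists_sum_norm_sq_le_of_mem_PW hσ hτ
  refine ⟨√B, Real.sqrt_nonneg B, fun f z => ?_⟩
  have hz := hB f f.2 {0} z
  simp only [Finset.sum_singleton, Int.cast_zero, add_zero] at hz
  refine (Real.le_sqrt_of_sq_le hz).trans_eq ?_
  rw [Real.sqrt_mul (by positivity), Real.sqrt_mul hB0, norm_toL2, l2Norm, mul_assoc 2,
    two_mul, Real.exp_add, Real.sqrt_mul_self (Real.exp_nonneg _)]

theorem injective_toL2 (hτ : 0 ≤ τ) : Function.Injective (toL2 τ) := by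
  obtain ⟨B, -, hB⟩ := exists_norm_apply_le_mul_norm_toL2 (σ := τ + 1) (by linarith) (lt_add_one τ)
  refine (injective_iff_map_eq_zero _).2 fun f hf => Subtype.ext (funext fun z => ?_)
  simpa [hf] using hB f z

theorem exists_norm_apply_sub_le_of_tendsto_toL2 (hτ : 0 ≤ τ) {u : ℕ → PWSubmodule τ}
    {g : Lp ℂ 2 (volume : Measure ℝ)}
    (hu : Filter.Tendsto (fun n => toL2 τ (u n)) Filter.atTop (nhds g)) :
    ∃ G : ℂ → ℂ, ∀ σ, τ < σ → ∃ B, 0 ≤ B ∧ ∀ n z,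
      ‖(u n : ℂ → ℂ) z - G z‖ ≤ B * ‖toL2 τ (u n) - g‖ * Real.exp (σ * |z.im|) := by
  have hbound : ∀ σ, τ < σ → ∃ B, 0 ≤ B ∧ ∀ n m z, ‖(u n : ℂ → ℂ) z - (u m : ℂ → ℂ) z‖ ≤
      B * ‖toL2 τ (u n) - toL2 τ (u m)‖ * Real.exp (σ * |z.im|) := fun σ hσ => by
    obtain ⟨B, hB0, hB⟩ := exists_norm_apply_le_mul_norm_toL2 (hτ.trans hσ.le) hσ
    exact ⟨B, hB0, fun n m z => by simpa using hB (u n - u m) z⟩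
  have hcauchy : ∀ z, CauchySeq fun n => (u n : ℂ → ℂ) z := fun z => by
    obtain ⟨B, -, hB⟩ := hbound (τ + 1) (lt_add_one τ)
    refine cauchySeq_iff_tendsto_dist_atTop_0.2 (squeeze_zero (fun _ => dist_nonneg)
      (fun p => (dist_eq_norm _ _).trans_le (hB p.1 p.2 z)) ?_)
    simpa [dist_eq_norm] using ((cauchySeq_iff_tendsto_dist_atTop_0.1 hu.cauchySeq).const_mul
      B).mul_const (Real.exp ((τ + 1) * |z.im|))
  choose G hG using fun z => cauchySeq_tendsto_of_complete (hcauchy z)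
  refine ⟨G, fun σ hσ => ?_⟩
  obtain ⟨B, hB0, hB⟩ := hbound σ hσ
  refine ⟨B, hB0, fun n z => le_of_tendsto_of_tendsto' ((hG z).const_sub _).norm ?_ (hB n · z)⟩
  exact ((hu.const_sub _).norm.const_mul B).mul_const _

theorem differentiable_of_norm_sub_le {u : ℕ → ℂ → ℂ} {G : ℂ → ℂ} {b : ℕ → ℝ} {K : ℂ → ℝ}
    (hu : ∀ n, Differentiable ℂ (u n)) (hb : Filter.Tendsto b Filter.atTop (nhds 0))
    (hK : Continuous K) (h : ∀ n z, ‖u n z - G z‖ ≤ b n * K z) : Differentiable ℂ G := by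
  have hlim : TendstoLocallyUniformlyOn u G Filter.atTop Set.univ := by
    rw [tendstoLocallyUniformlyOn_iff_forall_isCompact isOpen_univ]
    intro S _ hS
    obtain ⟨M, hM⟩ := hS.exists_bound_of_continuousOn hK.continuousOn
    have hbM : Filter.Tendsto (fun n => |b n| * M) Filter.atTop (nhds 0) := by
      simpa using hb.abs.mul_const M
    refine Metric.tendstoUniformlyOn_iff.2 fun ε hε => ?_
    filter_upwards [hbM.eventually_lt_const hε] with n hn z hz
    rw [dist_comm, dist_eq_norm]
    calc ‖u n z - G z‖ ≤ |b n * K z| := (h n z).trans (le_abs_self _)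
      _ ≤ |b n| * M := by
          rw [abs_mul]
          exact mul_le_mul_of_nonneg_left (hM z hz) (abs_nonneg _)
      _ < ε := hn
  exact differentiableOn_univ.1
    (hlim.differentiableOn (.of_forall fun n => (hu n).differentiableOn) isOpen_univ)

theorem ae_eq_of_tendsto_Lp {u : ℕ → Lp ℂ 2 (volume : Measure ℝ)} {g : Lp ℂ 2 (volume : Measure ℝ)}
    (hu : Filter.Tendsto u Filter.atTop (nhds g)) {v : ℕ → ℝ → ℂ} (huv : ∀ n, u n =ᵐ[volume] v n)
    {G : ℝ → ℂ} (hv : ∀ x, Filter.Tendsto (fun n => v n x) Filter.atTop (nhds (G x))) :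
    g =ᵐ[volume] G := by
  obtain ⟨φ, hφ, hlim⟩ := (tendstoInMeasure_of_tendsto_Lp hu).exists_seq_tendsto_ae
  filter_upwards [hlim, ae_all_iff.2 huv] with x hx hxv
  refine tendsto_nhds_unique hx ?_
  simpa only [hxv, Function.comp_def] using (hv x).comp hφ.tendsto_atTop

theorem isClosed_range_toL2 (hτ : 0 ≤ τ) : IsClosed (Set.range (toL2 τ)) := by
  refine IsSeqClosed.isClosed fun v g hv hvg => ?_
  choose u hu using hv
  obtain rfl : (fun n => toL2 τ (u n)) = v := funext hu
  obtain ⟨G, hG⟩ := exists_norm_apply_sub_le_of_tendsto_toL2 hτ hvg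
  have hzero : Filter.Tendsto (fun n => ‖toL2 τ (u n) - g‖) Filter.atTop (nhds 0) :=
    tendsto_iff_norm_sub_tendsto_zero.1 hvg
  obtain ⟨B, -, hB⟩ := hG (τ + 1) (lt_add_one τ)
  have hdiff : Differentiable ℂ G := differentiable_of_norm_sub_le (fun n => (u n).2.1)
    (by simpa using hzero.const_mul B) (by fun_prop) hB
  have htype : ExpTypeAtMost τ G := fun ε hε => by
    obtain ⟨C, hC⟩ := (u 0).2.2.1 ε hε
    obtain ⟨B, hB0, hB⟩ := hG (τ + ε) (lt_add_of_pos_right τ hε)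
    refine ⟨C + B * ‖toL2 τ (u 0) - g‖, fun z => ?_⟩
    calc ‖G z‖ ≤ ‖(u 0 : ℂ → ℂ) z‖ + ‖(u 0 : ℂ → ℂ) z - G z‖ := norm_le_insert _ _
      _ ≤ C * Real.exp ((τ + ε) * ‖z‖) +
          B * ‖toL2 τ (u 0) - g‖ * Real.exp ((τ + ε) * ‖z‖) := by
          refine add_le_add (hC z) ((hB 0 z).trans ?_)
          gcongr
          exact Complex.abs_im_le_norm z
      _ = _ := (add_mul _ _ _).symm
  have hae : g =ᵐ[volume] fun x : ℝ => G x := ae_eq_of_tendsto_Lp hvg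
    (fun n => (u n).2.2.2.coeFn_toLp) fun x => by
      refine tendsto_iff_norm_sub_tendsto_zero.2
        (squeeze_zero (fun _ => norm_nonneg _) (fun n => hB n x) ?_)
      simpa using hzero.const_mul B
  have hmem : MemLp (fun x : ℝ => G x) 2 := (memLp_congr_ae hae).1 (Lp.memLp g)
  exact ⟨⟨G, hdiff, htype, hmem⟩, Lp.ext (hmem.coeFn_toLp.trans hae.symm)⟩

theorem norm_mul_norm_dslope_zero_le (e : ℂ → ℂ) (z : ℂ) :
    ‖z‖ * ‖dslope e 0 z‖ ≤ ‖e z‖ + ‖e 0‖ := by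
  have hz : z * dslope e 0 z = e z - e 0 := by simpa using sub_smul_dslope e 0 z
  rw [← norm_mul, hz]
  exact norm_sub_le _ _

theorem differentiable_dslope {e : ℂ → ℂ} (he : Differentiable ℂ e) (c : ℂ) :
    Differentiable ℂ (dslope e c) :=
  differentiableOn_univ.1
    ((Complex.differentiableOn_dslope Filter.univ_mem).2 he.differentiableOn)

theorem exists_norm_dslope_zero_le {e : ℂ → ℂ} (he : Differentiable ℂ e) :
    ∃ C, 0 ≤ C ∧ ∀ z, ‖dslope e 0 z‖ ≤ C + ‖e z‖ := by
  obtain ⟨C, hC⟩ := (isCompact_closedBall (0 : ℂ) 1).exists_bound_of_continuousOn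
    (differentiable_dslope he 0).continuous.continuousOn
  have hC0 : 0 ≤ C := (norm_nonneg _).trans (hC 0 (by simp))
  refine ⟨C + ‖e 0‖, by positivity, fun z => ?_⟩
  rcases le_total ‖z‖ 1 with hz | hz
  · linarith [hC z (by simpa using hz), norm_nonneg (e 0), norm_nonneg (e z)]
  · linarith [norm_mul_norm_dslope_zero_le e z,
      le_mul_of_one_le_left (norm_nonneg (dslope e 0 z)) hz]

theorem dslope_zero_mem_PW {e : ℂ → ℂ} {M : ℝ} (hτ : 0 ≤ τ) (he : Differentiable ℂ e)
    (htype : ExpTypeAtMost τ e) (hM : ∀ x : ℝ, ‖e x‖ ≤ M) : dslope e 0 ∈ PW τ := by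
  obtain ⟨C, hC0, hC⟩ := exists_norm_dslope_zero_le he
  have hdiff := differentiable_dslope he 0
  refine mem_PW_of_integrable_norm_sq hdiff (fun ε hε => ?_) ?_
  · obtain ⟨D, hD⟩ := htype ε hε
    refine ⟨C + D, fun z => (hC z).trans ?_⟩
    rw [add_mul]
    exact add_le_add (le_mul_of_one_le_right hC0 (Real.one_le_exp (by positivity))) (hD z)
  · refine (integrable_inv_one_add_sq.const_mul ((C + M) ^ 2 + (M + ‖e 0‖) ^ 2)).mono'
      ((hdiff.continuous.comp Complex.continuous_ofReal).norm.pow 2).aestronglyMeasurable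
      (.of_forall fun x => ?_)
    have hx : (|x| * ‖dslope e 0 x‖) ^ 2 ≤ (M + ‖e 0‖) ^ 2 := by
      gcongr
      simpa using (norm_mul_norm_dslope_zero_le e x).trans (by gcongr; exact hM x)
    have hx' : ‖dslope e 0 x‖ ^ 2 ≤ (C + M) ^ 2 := by
      gcongr
      exact (hC x).trans (by gcongr; exact hM x)
    rw [mul_pow, sq_abs] at hx
    rw [Real.norm_of_nonneg (sq_nonneg _), ← div_eq_mul_inv, le_div_iff₀ (by positivity)]
    linarith

theorem exists_mem_PW_apply_zero_ne_zero (hτ : 0 < τ) : ∃ f ∈ PW τ, f 0 ≠ 0 := by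
  let e : ℂ → ℂ := fun z => Complex.exp (τ * Complex.I * z)
  have htype : ExpTypeAtMost τ e := fun ε hε => ⟨1, fun z => by
    rw [one_mul]
    refine (Complex.norm_exp_le_exp_norm _).trans (Real.exp_le_exp.2 ?_)
    simpa [abs_of_pos hτ] using
      mul_le_mul_of_nonneg_right (le_add_of_nonneg_right hε.le) (norm_nonneg z)⟩
  refine ⟨dslope e 0, dslope_zero_mem_PW (M := 1) hτ.le (by fun_prop) htype fun x => ?_, ?_⟩
  · simp [e, Complex.norm_exp]
  · have hderiv : HasDerivAt e (Complex.exp (τ * Complex.I * 0) * (τ * Complex.I * 1)) 0 :=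
      ((hasDerivAt_id (0 : ℂ)).const_mul _).cexp
    simp [hderiv.deriv, hτ.ne']

end PaleyWienerSpace

section MeasureFourier

variable (ν : Measure ℝ)

theorem measureFourier_eq_charFun (ξ : ℝ) :
    measureFourier ν ξ = charFun ν (-2 * Real.pi * ξ) := by
  rw [charFun_apply_real, measureFourier]
  congr 1 with α
  push_cast
  ring_nf

theorem norm_measureFourier_le (ξ : ℝ) : ‖measureFourier ν ξ‖ ≤ ν.real Set.univ := by
  rw [measureFourier_eq_charFun]
  exact norm_charFun_le _

variable [IsFiniteMeasure ν]

theorem norm_charFun_sub_le (s t : ℝ) :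
    ‖charFun ν s - charFun ν t‖ ≤ ∫ α : ℝ, ‖Complex.exp ((s - t : ℝ) * α * Complex.I) - 1‖ ∂ν := by
  have hint : ∀ u : ℝ, Integrable (fun α : ℝ => Complex.exp (u * α * Complex.I)) ν := fun u =>
    (integrable_const (1 : ℝ)).mono' (by fun_prop) (.of_forall fun α => by
      exact_mod_cast (Complex.norm_exp_ofReal_mul_I (u * α)).le)
  rw [charFun_apply_real, charFun_apply_real, ← integral_sub (hint s) (hint t)]
  refine (norm_integral_le_integral_norm _).trans_eq (integral_congr_ae (.of_forall fun α => ?_))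
  have hfactor : Complex.exp (s * α * Complex.I) - Complex.exp (t * α * Complex.I) =
      Complex.exp ((t * α : ℝ) * Complex.I) *
        (Complex.exp ((s - t : ℝ) * α * Complex.I) - 1) := by
    rw [mul_sub, ← Complex.exp_add, mul_one]
    push_cast
    ring_nf
  simp only [hfactor, norm_mul, Complex.norm_exp_ofReal_mul_I, one_mul]

theorem uniformContinuous_charFun : UniformContinuous (charFun ν) := by
  let ω : ℝ → ℝ := fun h => ∫ α : ℝ, ‖Complex.exp (h * α * Complex.I) - 1‖ ∂ν
  have hω : Continuous ω := continuous_of_dominated (bound := fun _ => 2) (fun h => by fun_prop)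
    (fun h => .of_forall fun α => by
      rw [norm_norm]
      refine (norm_sub_le _ _).trans_eq ?_
      rw [← Complex.ofReal_mul, Complex.norm_exp_ofReal_mul_I, norm_one, one_add_one_eq_two])
    (integrable_const _) (.of_forall fun α => by fun_prop)
  have hω0 : ω 0 = 0 := by simp [ω]
  refine Metric.uniformContinuous_iff.2 fun ε hε => ?_
  obtain ⟨δ, hδ, hδε⟩ := Metric.continuousAt_iff.1 hω.continuousAt ε hε
  refine ⟨δ, hδ, fun s t hst => ?_⟩
  rw [dist_eq_norm]
  refine (norm_charFun_sub_le ν s t).trans_lt ((le_abs_self _).trans_lt ?_)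
  have hclose : dist (s - t) 0 < δ := by rwa [dist_zero_right, ← dist_eq_norm]
  have hsmall := hδε hclose
  rwa [hω0, dist_zero_right] at hsmall

theorem uniformContinuous_measureFourier : UniformContinuous (measureFourier ν) := by
  simp_rw [funext (measureFourier_eq_charFun ν)]
  exact (uniformContinuous_charFun ν).comp (uniformContinuous_id.const_mul' _)

theorem integrable_mul_measureFourier {g : ℝ → ℂ} (hg : Integrable g) :
    Integrable fun x => g x * measureFourier ν x :=
  hg.mul_bdd (uniformContinuous_measureFourier ν).continuous.aestronglyMeasurable
    (.of_forall (norm_measureFourier_le ν))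

end MeasureFourier

section Thickness

theorem exists_integral_compl_Ioc_lt {q : ℝ → ℝ} (hq : Integrable q) {ε : ℝ} (hε : 0 < ε) :
    ∃ T : ℝ, ∫ x in (Set.Ioc (-T) T)ᶜ, q x < ε := by
  have hlim := (intervalIntegral_tendsto_integral hq Filter.tendsto_neg_atTop_atBot
    Filter.tendsto_id).const_sub (∫ x, q x)
  rw [sub_self] at hlim
  obtain ⟨T, hTε, hT⟩ :=
    ((hlim.eventually_lt_const hε).and (Filter.eventually_ge_atTop 0)).exists
  refine ⟨T, ?_⟩
  rwa [setIntegral_compl measurableSet_Ioc hq, ← intervalIntegral.integral_of_le (by linarith)]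

theorem exists_le_of_mul_integral_le_integral_mul {q m : ℝ → ℝ} {c V : ℝ} (hq : Integrable q)
    (hq0 : ∀ x, 0 ≤ q x) (hqpos : 0 < ∫ x, q x) (hm0 : ∀ x, 0 ≤ m x) (hmV : ∀ x, m x ≤ V)
    (hc : 0 < c) (h : ∀ t, c * ∫ x, q x ≤ ∫ x, q x * m (x + t)) :
    ∃ T, ∀ t, ∃ u ∈ Set.Ioc (-T) T, c / 2 ≤ m (u + t) := by
  have hV : 0 ≤ V := (hm0 0).trans (hmV 0)
  obtain ⟨T, hT⟩ := exists_integral_compl_Ioc_lt hq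
    (ε := c / 2 * (∫ x, q x) / (V + 1)) (by positivity)
  refine ⟨T, fun t => ?_⟩
  by_contra! hlt
  have htail : Integrable ((Set.Ioc (-T) T)ᶜ.indicator q) :=
    hq.indicator measurableSet_Ioc.compl
  have hle : ∫ x, q x * m (x + t) ≤
      ∫ x, (c / 2 * q x + V * (Set.Ioc (-T) T)ᶜ.indicator q x) := by
    refine integral_mono_of_nonneg (.of_forall fun x => mul_nonneg (hq0 x) (hm0 _))
      ((hq.const_mul _).add (htail.const_mul _)) (.of_forall fun x => ?_)
    by_cases hx : x ∈ Set.Ioc (-T) T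
    · simpa [hx, mul_comm] using mul_le_mul_of_nonneg_left (hlt x hx).le (hq0 x)
    · have := mul_le_mul_of_nonneg_left (hmV (x + t)) (hq0 x)
      have := mul_nonneg hc.le (hq0 x)
      simp only [Set.indicator_of_mem (Set.mem_compl hx)]
      linarith
  rw [integral_add (hq.const_mul _) (htail.const_mul _), integral_const_mul, integral_const_mul,
    integral_indicator measurableSet_Ioc.compl] at hle
  rw [lt_div_iff₀ (by positivity)] at hT
  have htail0 : 0 ≤ ∫ x in (Set.Ioc (-T) T)ᶜ, q x := integral_nonneg hq0
  linarith [h t]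

theorem exists_isThickWeight {m : ℝ → ℝ} (hm : UniformContinuous m) (hm0 : ∀ x, 0 ≤ m x)
    {c T : ℝ} (hc : 0 < c) (h : ∀ t, ∃ u ∈ Set.Ioc (-T) T, c ≤ m (u + t)) :
    ∃ L η δ, IsThickWeight L η δ m := by
  obtain ⟨η, hη, hηc⟩ := Metric.uniformContinuous_iff.1 hm (c / 2) (by positivity)
  refine ⟨2 * T + η / 2, η / 2, c / 2, by positivity, by positivity, hm0, fun x => ?_⟩
  obtain ⟨u, hu, huc⟩ := h (x + T)
  refine ⟨u + (x + T), by linarith [hu.1], by linarith [hu.2], fun v hv => ?_⟩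
  have hclose : |v - (u + (x + T))| < η := abs_lt.2 ⟨by linarith [hv.1], by linarith [hv.2]⟩
  linarith [(abs_lt.1 (hηc hclose)).1]

theorem sq_mul_integral_le_norm_nuNormSq {ν : Measure ℝ} {f : ℂ → ℂ} {a : ℝ} (ha : 0 ≤ a)
    (h : a * l2Norm f ≤ nuNorm ν f) : a ^ 2 * ∫ x : ℝ, ‖f x‖ ^ 2 ≤ ‖nuNormSq ν f‖ := by
  have hl2 : l2Norm f ^ 2 = ∫ x : ℝ, ‖f x‖ ^ 2 :=
    Real.sq_sqrt (integral_nonneg fun _ => sq_nonneg _)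
  calc a ^ 2 * ∫ x : ℝ, ‖f x‖ ^ 2 = (a * l2Norm f) ^ 2 := by rw [mul_pow, hl2]
    _ ≤ √‖nuNormSq ν f‖ ^ 2 := by
        refine pow_le_pow_left₀ (mul_nonneg ha (Real.sqrt_nonneg _)) (h.trans ?_) 2
        exact Real.sqrt_le_sqrt (Complex.re_le_norm _)
    _ = ‖nuNormSq ν f‖ := Real.sq_sqrt (norm_nonneg _)

theorem norm_nuNormSq_le (ν : Measure ℝ) (f : ℂ → ℂ) :
    ‖nuNormSq ν f‖ ≤ ∫ x : ℝ, ‖f x‖ ^ 2 * ‖measureFourier ν x‖ :=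
  (norm_integral_le_integral_norm _).trans_eq (by simp)

theorem integral_norm_sq_pos {τ : ℝ} (hτ : 0 ≤ τ) {f : ℂ → ℂ} (hf : f ∈ PW τ) (hf0 : f ≠ 0) :
    0 < ∫ x : ℝ, ‖f x‖ ^ 2 := by
  have hne : toL2 τ ⟨f, hf⟩ ≠ 0 := fun h =>
    hf0 (congrArg Subtype.val ((map_eq_zero_iff _ (injective_toL2 hτ)).1 h))
  have hpos := norm_pos_iff.2 hne
  rw [norm_toL2] at hpos
  exact Real.sqrt_pos.1 hpos

theorem exists_isThickWeight_norm_measureFourier {ν : Measure ℝ} [IsFiniteMeasure ν] {τ a : ℝ}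
    (hτ : 0 < τ) (ha : 0 < a) (h : ∀ f ∈ PW τ, a * l2Norm f ≤ nuNorm ν f) :
    ∃ L η δ, IsThickWeight L η δ fun x => ‖measureFourier ν x‖ := by
  obtain ⟨φ, hφ, hφ0⟩ := exists_mem_PW_apply_zero_ne_zero hτ
  have hφpos := integral_norm_sq_pos hτ.le hφ fun h => hφ0 (congrFun h 0)
  have htranslate : ∀ t : ℝ, a ^ 2 * ∫ x : ℝ, ‖φ x‖ ^ 2 ≤
      ∫ x : ℝ, ‖φ x‖ ^ 2 * ‖measureFourier ν (x + t)‖ := fun t => by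
    have hle := (sq_mul_integral_le_norm_nuNormSq ha.le
      (h _ (comp_add_const_mem_PW hτ.le hφ (-t)))).trans (norm_nuNormSq_le ν _)
    simp only [← Complex.ofReal_add] at hle
    rw [integral_add_right_eq_self (fun x : ℝ => ‖φ x‖ ^ 2) (-t),
      ← integral_add_right_eq_self (fun x : ℝ => ‖φ (x + -t : ℝ)‖ ^ 2 * ‖measureFourier ν x‖) t]
      at hle
    simpa using hle
  obtain ⟨T, hT⟩ := exists_le_of_mul_integral_le_integral_mul
    (integrable_norm_sq_of_mem_PW hφ) (fun _ => sq_nonneg _) hφpos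
    (m := fun x => ‖measureFourier ν x‖) (fun _ => norm_nonneg _) (norm_measureFourier_le ν)
    (pow_pos ha 2) htranslate
  exact exists_isThickWeight (uniformContinuous_norm.comp (uniformContinuous_measureFourier ν))
    (fun _ => norm_nonneg _) (by positivity) hT

theorem nuSpace_eq_PW {Δ : ℝ} (hΔ : 0 < Δ) {ν : Measure ℝ} [IsFiniteMeasure ν] {a : ℝ}
    (ha : 0 < a) (h : ∀ f ∈ PW (Real.pi * Δ), a * l2Norm f ≤ nuNorm ν f) :
    nuSpace Δ ν = PW (Real.pi * Δ) := by
  have hτ : 0 < Real.pi * Δ := by positivity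
  obtain ⟨L, η, δ, hthick⟩ := exists_isThickWeight_norm_measureFourier hτ ha h
  refine Set.Subset.antisymm (fun f hf => ?_) fun f hf =>
    ⟨hf.1, hf.2.1, integrable_mul_measureFourier ν (integrable_norm_sq_of_mem_PW hf).ofReal⟩
  obtain ⟨C, hC⟩ := hf.2.1.exists_le (lt_add_one _)
  exact mem_PW_of_integrable_norm_sq hf.1 hf.2.1 <|
    hthick.integrable_norm_sq (by positivity) hf.1 hC (by simpa using hf.2.2.norm)

end Thickness

section ContourShift

variable {h : ℂ → ℂ} {D M ρ t y α : ℝ}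

theorem integrable_and_integral_norm_le_of_sum_translates_le (hh : Continuous h)
    (hM : ∀ (s : Finset ℤ) (x : ℝ), ∑ k ∈ s, ‖h (x + t * Complex.I + k)‖ ≤ M) :
    Integrable (fun x : ℝ => h (x + t * Complex.I)) ∧
      ∫ x : ℝ, ‖h (x + t * Complex.I)‖ ≤ M := by
  have hcont : Continuous fun x : ℝ => h (x + t * Complex.I) := by fun_prop
  have hline := integrable_and_integral_le_of_sum_translates_le (L := 1) (D := M) hcont.norm
    (fun _ => norm_nonneg _) one_pos fun s x => (hM s x).trans' <| le_of_eq <|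
      Finset.sum_congr rfl fun k _ => by push_cast; ring_nf
  rw [one_mul] at hline
  exact ⟨(integrable_norm_iff hcont.aestronglyMeasurable).1 hline.1, hline.2⟩

theorem tendsto_cofinite_of_sum_translates_le {z : ℂ}
    (hM : ∀ s : Finset ℤ, ∑ k ∈ s, ‖h (z + k)‖ ≤ M) :
    Filter.Tendsto (fun k : ℤ => h (z + k)) Filter.cofinite (nhds 0) :=
  tendsto_zero_iff_norm_tendsto_zero.2
    (summable_of_sum_le (fun _ => norm_nonneg _) hM).tendsto_cofinite_zero

theorem tendsto_integral_side_of_sum_translates_le (hh : Continuous h)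
    (hM : ∀ (s : Finset ℤ) (x : ℝ), ∀ t ∈ Set.uIcc 0 y, ∑ k ∈ s, ‖h (x + t * Complex.I + k)‖ ≤ M)
    {m : ℕ → ℤ} (hm : Function.Injective m) :
    Filter.Tendsto (fun N : ℕ => ∫ t in (0 : ℝ)..y, h ((m N : ℝ) + t * Complex.I))
      Filter.atTop (nhds 0) := by
  have hlim := intervalIntegral.tendsto_integral_filter_of_dominated_convergence
    (μ := volume) (a := 0) (b := y) (l := Filter.atTop)
    (F := fun (N : ℕ) (t : ℝ) => h ((m N : ℝ) + t * Complex.I)) (f := fun _ => 0) (fun _ => M)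
    (.of_forall fun N => Continuous.aestronglyMeasurable (by fun_prop))
    (.of_forall fun N => .of_forall fun t ht => by
      simpa using hM {0} (m N) t (Set.uIoc_subset_uIcc ht))
    intervalIntegrable_const
    (.of_forall fun t ht => by
      have hdecay := (tendsto_cofinite_of_sum_translates_le fun s => by
        simpa using hM s 0 t (Set.uIoc_subset_uIcc ht)).comp hm.tendsto_cofinite
      rw [Nat.cofinite_eq_atTop] at hdecay
      simpa [Function.comp_def, add_comm] using hdecay)
  simpa using hlim

theorem integral_eq_integral_add_mul_I (hd : Differentiable ℂ h)
    (hM : ∀ (s : Finset ℤ) (x : ℝ), ∀ t ∈ Set.uIcc 0 y,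
      ∑ k ∈ s, ‖h (x + t * Complex.I + k)‖ ≤ M) :
    ∫ x : ℝ, h x = ∫ x : ℝ, h (x + y * Complex.I) := by
  have hint : ∀ t ∈ Set.uIcc 0 y, Integrable fun x : ℝ => h (x + t * Complex.I) := fun t ht =>
    (integrable_and_integral_norm_le_of_sum_translates_le hd.continuous fun s x =>
      hM s x t ht).1
  have hN : Filter.Tendsto (fun N : ℕ => (N : ℝ)) Filter.atTop Filter.atTop :=
    tendsto_natCast_atTop_atTop
  have hhoriz : ∀ t ∈ Set.uIcc 0 y, Filter.Tendsto
      (fun N : ℕ => ∫ x in (-(N : ℝ))..N, h (x + t * Complex.I)) Filter.atTop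
      (nhds (∫ x : ℝ, h (x + t * Complex.I))) := fun t ht =>
    intervalIntegral_tendsto_integral (hint t ht) (Filter.tendsto_neg_atTop_atBot.comp hN) hN
  have hright := (tendsto_integral_side_of_sum_translates_le hd.continuous hM
    (Nat.cast_injective (R := ℤ))).const_smul Complex.I
  have hleft := (tendsto_integral_side_of_sum_translates_le hd.continuous hM
    (neg_injective.comp (Nat.cast_injective (R := ℤ)))).const_smul Complex.I
  have hboundary := (((hhoriz 0 Set.left_mem_uIcc).sub (hhoriz y Set.right_mem_uIcc)).add
    hright).sub hleft
  have hcauchy : ∀ N : ℕ, (∫ x in (-(N : ℝ))..N, h (x + (0 : ℝ) * Complex.I)) -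
      (∫ x in (-(N : ℝ))..N, h (x + y * Complex.I)) +
      (Complex.I • ∫ t in (0 : ℝ)..y, h (((N : ℤ) : ℝ) + t * Complex.I)) -
      (Complex.I • ∫ t in (0 : ℝ)..y,
        h (((((fun n => -n) ∘ ((↑) : ℕ → ℤ)) N : ℤ) : ℝ) + t * Complex.I)) = 0 := fun N => by
    simpa using Complex.integral_boundary_rect_eq_zero_of_differentiableOn h
      ((-(N : ℝ) : ℝ) : ℂ) ((N : ℝ) + y * Complex.I) hd.differentiableOn
  simp_rw [hcauchy] at hboundary
  simpa [sub_eq_zero] using tendsto_nhds_unique hboundary tendsto_const_nhds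

theorem norm_fourier_le_of_sum_translates_le (hd : Differentiable ℂ h) (hD : 0 ≤ D) (hρ : 0 ≤ ρ)
    (hsum : ∀ (s : Finset ℤ) (z : ℂ), ∑ k ∈ s, ‖h (z + k)‖ ≤ D * Real.exp (ρ * |z.im|))
    (α y : ℝ) :
    ‖𝓕 (fun x : ℝ => h x) α‖ ≤ D * Real.exp (2 * Real.pi * α * y + ρ * |y|) := by
  let H : ℂ → ℂ := fun z => Complex.exp (-2 * Real.pi * Complex.I * α * z) * h z
  have hH : Differentiable ℂ H := by fun_prop
  have hnormH : ∀ z, ‖H z‖ = Real.exp (2 * Real.pi * α * z.im) * ‖h z‖ := fun z => by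
    rw [norm_mul, Complex.norm_exp]
    simp
  have hsumH : ∀ (s : Finset ℤ) (x t : ℝ), ∑ k ∈ s, ‖H (x + t * Complex.I + k)‖ ≤
      D * Real.exp (2 * Real.pi * α * t + ρ * |t|) := fun s x t => by
    have hst := mul_le_mul_of_nonneg_left (hsum s (x + t * Complex.I))
      (Real.exp_nonneg (2 * Real.pi * α * t))
    simp only [Complex.add_im, Complex.ofReal_im, Complex.im_ofReal_mul, Complex.I_im, mul_one,
      zero_add] at hst
    simpa [hnormH, Finset.mul_sum, Real.exp_add, mul_left_comm] using hst
  have hfourier : 𝓕 (fun x : ℝ => h x) α = ∫ x : ℝ, H x := by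
    rw [Real.fourier_real_eq_integral_exp_smul]
    refine integral_congr_ae (.of_forall fun x => ?_)
    simp only [H, smul_eq_mul]
    push_cast
    ring_nf
  have hshift : ∫ x : ℝ, H x = ∫ x : ℝ, H (x + y * Complex.I) := by
    refine integral_eq_integral_add_mul_I hH
      (M := D * Real.exp (|2 * Real.pi * α| * |y| + ρ * |y|)) fun s x t ht => ?_
    have hty : |t| ≤ |y| := by simpa using Set.abs_sub_left_of_mem_uIcc ht
    refine (hsumH s x t).trans ?_
    have : 2 * Real.pi * α * t ≤ |2 * Real.pi * α| * |y| :=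
      (le_abs_self _).trans (by rw [abs_mul _ t]; gcongr)
    gcongr
  rw [hfourier, hshift]
  exact (norm_integral_le_integral_norm _).trans
    (integrable_and_integral_norm_le_of_sum_translates_le hH.continuous fun s x =>
      hsumH s x y).2

theorem fourier_eq_zero_of_sum_translates_le (hd : Differentiable ℂ h) (hD : 0 ≤ D) (hρ : 0 ≤ ρ)
    (hsum : ∀ (s : Finset ℤ) (z : ℂ), ∑ k ∈ s, ‖h (z + k)‖ ≤ D * Real.exp (ρ * |z.im|))
    (hα : ρ < 2 * Real.pi * |α|) :
    𝓕 (fun x : ℝ => h x) α = 0 := by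
  have hdecay : Filter.Tendsto (fun Y : ℝ => D * Real.exp (-((2 * Real.pi * |α| - ρ) * Y)))
      Filter.atTop (nhds 0) := by
    simpa [Function.comp_def] using (Real.tendsto_exp_neg_atTop_nhds_zero.comp
      (Filter.tendsto_id.const_mul_atTop (sub_pos.2 hα))).const_mul D
  refine norm_le_zero_iff.1 (ge_of_tendsto hdecay ?_)
  filter_upwards [Filter.eventually_ge_atTop 0] with Y hY
  rcases le_total 0 α with hα0 | hα0
  · refine (norm_fourier_le_of_sum_translates_le hd hD hρ hsum α (-Y)).trans_eq ?_
    rw [abs_neg, abs_of_nonneg hY, abs_of_nonneg hα0]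
    ring_nf
  · refine (norm_fourier_le_of_sum_translates_le hd hD hρ hsum α Y).trans_eq ?_
    rw [abs_of_nonneg hY, abs_of_nonpos hα0]
    ring_nf

end ContourShift

section SpectralSupport

variable {τ α : ℝ} {k : ℂ → ℂ}

theorem fourier_norm_sq_eq_zero (hτ : 0 ≤ τ) (hk : k ∈ PW τ) (hα : τ < Real.pi * |α|) :
    𝓕 (fun x : ℝ => ((‖k x‖ ^ 2 : ℝ) : ℂ)) α = 0 := by
  obtain ⟨σ, hτσ, hσα⟩ := exists_between hα
  have hσ : 0 ≤ σ := hτ.trans hτσ.le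
  obtain ⟨B, hB, hsum⟩ := exists_sum_norm_sq_le_of_mem_PW hσ hτσ
  have hnorm : ∀ z, ‖k z * conj (k (conj z))‖ ≤ (‖k z‖ ^ 2 + ‖k (conj z)‖ ^ 2) / 2 := fun z => by
    rw [norm_mul, RCLike.norm_conj]
    linarith [two_mul_le_add_sq ‖k z‖ ‖k (conj z)‖]
  have hconj : Differentiable ℂ fun z => conj (k (conj z)) := fun z => by
    simpa [Function.comp_def] using (hk.1 (conj z)).conj_conj
  have hsumk : ∀ (s : Finset ℤ) (z : ℂ), ∑ j ∈ s, ‖k (z + j) * conj (k (conj (z + j)))‖ ≤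
      B * (∫ x : ℝ, ‖k x‖ ^ 2) * Real.exp (2 * σ * |z.im|) := fun s z => by
    have hz := hsum k hk s z
    have hz' := hsum k hk s (conj z)
    rw [Complex.conj_im, abs_neg] at hz'
    refine (Finset.sum_le_sum fun (j : ℤ) _ => hnorm (z + j)).trans ?_
    simp only [map_add, map_intCast]
    rw [← Finset.sum_div, Finset.sum_add_distrib]
    linarith
  have hvanish := fourier_eq_zero_of_sum_translates_le (α := α)
    (h := fun z => k z * conj (k (conj z))) (hk.1.mul hconj)
    (mul_nonneg hB (integral_nonneg fun x : ℝ => sq_nonneg ‖k x‖)) (by positivity) hsumk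
    (by linarith)
  simpa only [Complex.conj_ofReal, Complex.mul_conj', Complex.ofReal_pow] using hvanish

end SpectralSupport

section TestFunction

theorem continuous_fourier_of_integrable {E : Type*} [NormedAddCommGroup E] [NormedSpace ℂ E]
    {g : ℝ → E} (hg : Integrable g) : Continuous (𝓕 g) :=
  VectorFourier.fourierIntegral_continuous Real.continuous_fourierChar
    (innerSL ℝ).continuous₂ hg

theorem integral_fourier_eq_integral_mul_measureFourier (ν : Measure ℝ) [IsFiniteMeasure ν]
    {g : ℝ → ℂ} (hg : Integrable g) :
    ∫ α, 𝓕 g α ∂ν = ∫ x, g x * measureFourier ν x := by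
  have hflip := VectorFourier.integral_fourierIntegral_smul_eq_flip (L := innerₗ ℝ) (ν := ν)
    Real.continuous_fourierChar (innerSL ℝ).continuous₂ hg (integrable_const (1 : ℂ))
  simp only [smul_eq_mul, mul_one] at hflip
  refine hflip.trans (integral_congr_ae (.of_forall fun x => ?_))
  simp only [VectorFourier.fourierIntegral, measureFourier]
  congr 2 with α
  rw [Circle.smul_def, Real.fourierChar_apply, smul_eq_mul, mul_one]
  simp only [flip_innerₗ, innerₗ_apply_apply, RCLike.inner_apply, Real.ringHom_apply, mul_neg,
    Complex.ofReal_neg, Complex.ofReal_mul, Complex.ofReal_ofNat, neg_mul]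
  ring_nf

theorem phi_eq_re_integral {Δ : ℝ} {ν : Measure ℝ} [IsFiniteMeasure ν]
    (hν : ν (Set.Icc (-Δ) Δ)ᶜ = 0) {g : ℝ → ℝ} (hg : Integrable g) :
    phi Δ ν g = (∫ x : ℝ, (g x : ℂ) * measureFourier ν x).re := by
  have hint : Integrable (𝓕 fun x : ℝ => (g x : ℂ)) ν :=
    (integrable_const (∫ x : ℝ, ‖(g x : ℂ)‖)).mono'
      (continuous_fourier_of_integrable hg.ofReal).aestronglyMeasurable
      (.of_forall fun α => VectorFourier.norm_fourierIntegral_le_integral_norm _ _ _ _ α)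
  rw [phi, Measure.restrict_eq_self_of_ae_mem (ae_iff.2 hν),
    ← integral_fourier_eq_integral_mul_measureFourier ν (g := fun x => (g x : ℂ)) hg.ofReal]
  exact integral_re hint

theorem conj_measureFourier (ν : Measure ℝ) (ξ : ℝ) :
    conj (measureFourier ν ξ) = measureFourier ν (-ξ) := by
  rw [measureFourier_eq_charFun, measureFourier_eq_charFun, ← charFun_neg, mul_neg]

theorem comp_neg_mem_PW {τ : ℝ} {f : ℂ → ℂ} (hf : f ∈ PW τ) : (fun z => f (-z)) ∈ PW τ := by
  refine mem_PW_of_integrable_norm_sq (hf.1.comp differentiable_neg) (fun ε hε => ?_) ?_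
  · obtain ⟨C, hC⟩ := hf.2.1 ε hε
    exact ⟨C, fun z => by simpa using hC (-z)⟩
  · simpa using (integrable_norm_sq_of_mem_PW hf).comp_neg

theorem nuNormSq_comp_neg (ν : Measure ℝ) (f : ℂ → ℂ) :
    nuNormSq ν (fun z => f (-z)) = conj (nuNormSq ν f) := by
  rw [nuNormSq, nuNormSq, ← integral_conj, ← integral_neg_eq_self]
  simp [conj_measureFourier]

/-- The function `x ↦ |k(x)|² + |k(-x)|²` on the real line, an even nonnegative function which
serves as a test function in the extremal problem when `k` lies in the Paley-Wiener space. -/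
noncomputable def symmNormSq (k : ℂ → ℂ) (x : ℝ) : ℝ :=
  ‖k x‖ ^ 2 + ‖k (-x)‖ ^ 2

variable {Δ τ : ℝ} {k : ℂ → ℂ}

theorem integrable_symmNormSq (hk : k ∈ PW τ) : Integrable (symmNormSq k) :=
  (integrable_norm_sq_of_mem_PW hk).add (integrable_norm_sq_of_mem_PW (comp_neg_mem_PW hk))

theorem fourier_symmNormSq_eq_zero {α : ℝ} (hτ : 0 ≤ τ) (hk : k ∈ PW τ)
    (hα : τ < Real.pi * |α|) : 𝓕 (fun x : ℝ => (symmNormSq k x : ℂ)) α = 0 := by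
  have hint : ∀ f ∈ PW τ, Integrable fun x : ℝ => ((‖f x‖ ^ 2 : ℝ) : ℂ) := fun f hf =>
    (integrable_norm_sq_of_mem_PW hf).ofReal
  have hadd := congrFun (VectorFourier.fourierIntegral_add (L := innerₗ ℝ)
    Real.continuous_fourierChar (innerSL ℝ).continuous₂ (hint k hk)
    (hint _ (comp_neg_mem_PW hk))) α
  simp only [symmNormSq, Complex.ofReal_add]
  refine hadd.trans ?_
  exact (congrArg₂ (· + ·) (fourier_norm_sq_eq_zero hτ hk hα)
    (fourier_norm_sq_eq_zero hτ (comp_neg_mem_PW hk) hα)).trans (add_zero 0)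

theorem cohnElkiesClass_symmNormSq (hΔ : 0 ≤ Δ) (hk : k ∈ PW (Real.pi * Δ)) :
    CohnElkiesClass Δ (symmNormSq k) := by
  have hcont : Continuous k := hk.1.continuous
  have hzero : ∀ α ∉ Set.Icc (-Δ) Δ, 𝓕 (fun x : ℝ => (symmNormSq k x : ℂ)) α = 0 :=
    fun α hα => fourier_symmNormSq_eq_zero (by positivity) hk
      (mul_lt_mul_of_pos_left (not_le.1 fun h => hα (abs_le.1 h)) Real.pi_pos)
  exact
    { continuous := by unfold symmNormSq; fun_prop
      even := fun x => by simp [symmNormSq, add_comm]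
      integrable := integrable_symmNormSq hk
      integrable_fourier := (continuous_fourier_of_integrable
        (integrable_symmNormSq hk).ofReal).integrable_of_hasCompactSupport
          (.intro isCompact_Icc hzero)
      fourier_nonpos := fun α hα => by rw [realFourier, hzero α hα, Complex.zero_re]
      nonneg := fun x => by unfold symmNormSq; positivity }

theorem phi_symmNormSq {ν : Measure ℝ} [IsFiniteMeasure ν] (hν : ν (Set.Icc (-Δ) Δ)ᶜ = 0)
    (hk : k ∈ PW τ) : phi Δ ν (symmNormSq k) = 2 * (nuNormSq ν k).re := by
  have hint : ∀ f ∈ PW τ, Integrable fun x : ℝ => ((‖f x‖ ^ 2 : ℝ) : ℂ) * measureFourier ν x :=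
    fun f hf => integrable_mul_measureFourier ν (integrable_norm_sq_of_mem_PW hf).ofReal
  have hsplit : ∫ x : ℝ, (symmNormSq k x : ℂ) * measureFourier ν x =
      nuNormSq ν k + nuNormSq ν fun z => k (-z) := by
    rw [nuNormSq, nuNormSq, ← integral_add (hint k hk) (hint _ (comp_neg_mem_PW hk))]
    simp [symmNormSq, add_mul]
  rw [phi_eq_re_integral hν (integrable_symmNormSq hk), hsplit, nuNormSq_comp_neg,
    Complex.add_conj, Complex.ofReal_re]

theorem extremalConst_le_of_mem_PW (hΔ : 0 ≤ Δ) {ν : Measure ℝ} [IsFiniteMeasure ν]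
    (hν : ν (Set.Icc (-Δ) Δ)ᶜ = 0) (hk : k ∈ PW (Real.pi * Δ)) (hk0 : k 0 ≠ 0) :
    extremalConst Δ ν ≤ (((nuNormSq ν k).re / ‖k 0‖ ^ 2 : ℝ) : EReal) := by
  have hzero : symmNormSq k 0 = 2 * ‖k 0‖ ^ 2 := by
    rw [symmNormSq, Complex.ofReal_zero, neg_zero, two_mul]
  refine sInf_le ⟨symmNormSq k, cohnElkiesClass_symmNormSq hΔ hk, ?_, ?_⟩
  · rw [hzero]
    positivity
  · rw [phi_symmNormSq hν hk, hzero, mul_div_mul_left _ _ two_ne_zero]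

end TestFunction

section NuForm

variable {τ : ℝ} {f g h : ℂ → ℂ}

theorem integrable_mul_conj_of_mem_PW (hf : f ∈ PW τ) (hg : g ∈ PW τ) :
    Integrable fun x : ℝ => f x * conj (g x) :=
  hf.2.2.integrable_mul (Complex.conjCLE.lipschitz.comp_memLp (map_zero _) hg.2.2)

variable (ν : Measure ℝ)

theorem nuForm_self (f : ℂ → ℂ) : nuForm ν f f = nuNormSq ν f := by
  simp only [nuForm, nuNormSq, Complex.mul_conj', Complex.ofReal_pow]

theorem nuForm_smul_left (c : ℂ) (f g : ℂ → ℂ) : nuForm ν (c • f) g = c * nuForm ν f g := by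
  simp only [nuForm, ← integral_const_mul, Pi.smul_apply, smul_eq_mul, mul_assoc]

theorem nuForm_smul_right (c : ℂ) (f g : ℂ → ℂ) :
    nuForm ν f (c • g) = conj c * nuForm ν f g := by
  simp only [nuForm, ← integral_const_mul, Pi.smul_apply, smul_eq_mul, map_mul, mul_assoc,
    mul_left_comm]

variable [IsFiniteMeasure ν]

theorem nuForm_add_left (hf : f ∈ PW τ) (hg : g ∈ PW τ) (hh : h ∈ PW τ) :
    nuForm ν (f + g) h = nuForm ν f h + nuForm ν g h := by
  simp only [nuForm, Pi.add_apply, add_mul]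
  exact integral_add (integrable_mul_measureFourier ν (integrable_mul_conj_of_mem_PW hf hh))
    (integrable_mul_measureFourier ν (integrable_mul_conj_of_mem_PW hg hh))

theorem nuForm_add_right (hf : f ∈ PW τ) (hg : g ∈ PW τ) (hh : h ∈ PW τ) :
    nuForm ν f (g + h) = nuForm ν f g + nuForm ν f h := by
  simp only [nuForm, Pi.add_apply, map_add, mul_add, add_mul]
  exact integral_add (integrable_mul_measureFourier ν (integrable_mul_conj_of_mem_PW hf hg))
    (integrable_mul_measureFourier ν (integrable_mul_conj_of_mem_PW hf hh))

theorem nuNormSq_add (hf : f ∈ PW τ) (hg : g ∈ PW τ) :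
    nuNormSq ν (f + g) = nuNormSq ν f + nuNormSq ν g + (nuForm ν f g + nuForm ν g f) := by
  have hfg : f + g ∈ PW τ := (PWSubmodule τ).add_mem hf hg
  simp only [← nuForm_self, nuForm_add_left ν hf hg hfg, nuForm_add_right ν hf hf hg,
    nuForm_add_right ν hg hf hg]
  ring

theorem conj_nuForm_of_im_nuNormSq_eq_zero (h : ∀ f ∈ PW τ, (nuNormSq ν f).im = 0)
    (hf : f ∈ PW τ) (hg : g ∈ PW τ) : conj (nuForm ν f g) = nuForm ν g f := by
  have him : ∀ p ∈ PW τ, (nuForm ν f p + nuForm ν p f).im = 0 := fun p hp => by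
    have hadd := congrArg Complex.im (nuNormSq_add ν hf hp)
    simpa [h _ ((PWSubmodule τ).add_mem hf hp), h f hf, h p hp] using hadd.symm
  have hone := him g hg
  have hI := him _ ((PWSubmodule τ).smul_mem Complex.I hg)
  rw [nuForm_smul_left, nuForm_smul_right] at hI
  simp only [Complex.add_im, Complex.mul_im, Complex.conj_I, Complex.neg_re, Complex.neg_im,
    Complex.I_re, Complex.I_im] at hone hI
  apply Complex.ext
  · rw [Complex.conj_re]
    linarith
  · rw [Complex.conj_im]
    linarith

end NuForm

/-- The form defined by `ν` is real on the diagonal of the Paley-Wiener space `PW τ`, and the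
associated norm is equivalent to that of `L²(ℝ)`, with constants `a` and `b`. -/
structure NormEquivalence (τ : ℝ) (ν : Measure ℝ) (a b : ℝ) : Prop where
  type_nonneg : 0 ≤ τ
  lower_pos : 0 < a
  im_eq_zero : ∀ f ∈ PW τ, (nuNormSq ν f).im = 0
  lower_le : ∀ f ∈ PW τ, a * l2Norm f ≤ nuNorm ν f
  le_upper : ∀ f ∈ PW τ, nuNorm ν f ≤ b * l2Norm f

namespace NormEquivalence

variable {τ a b : ℝ} {ν : Measure ℝ} (h : NormEquivalence τ ν a b)

include h in
theorem re_nuNormSq_pos {f : ℂ → ℂ} (hf : f ∈ PW τ) (hf0 : f ≠ 0) : 0 < (nuNormSq ν f).re :=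
  Real.sqrt_pos.1 <| (mul_pos h.lower_pos
    (Real.sqrt_pos.2 (integral_norm_sq_pos h.type_nonneg hf hf0))).trans_le (h.lower_le f hf)

/-- The Paley-Wiener space `PW τ` as the carrier of the inner product defined by `ν`. -/
def Space (_h : NormEquivalence τ ν a b) : Type := PWSubmodule τ

noncomputable instance : AddCommGroup h.Space := inferInstanceAs (AddCommGroup (PWSubmodule τ))

noncomputable instance : Module ℂ h.Space := inferInstanceAs (Module ℂ (PWSubmodule τ))

/-- The identity map from the Hilbert space to the Paley-Wiener space, which carries no norm. -/
def toPW : h.Space ≃ₗ[ℂ] PWSubmodule τ :=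
  LinearEquiv.refl ℂ (PWSubmodule τ)

variable [IsFiniteMeasure ν]

/-- The inner product defined by `ν` on the Paley-Wiener space, with the arguments of `nuForm`
exchanged because Mathlib's inner products are conjugate linear in the first variable. -/
@[reducible] noncomputable def core : InnerProductSpace.Core ℂ h.Space where
  inner g f := nuForm ν (h.toPW f) (h.toPW g)
  conj_inner_symm f g :=
    conj_nuForm_of_im_nuNormSq_eq_zero ν h.im_eq_zero (h.toPW f).2 (h.toPW g).2
  re_inner_nonneg f := by
    rw [nuForm_self]
    rcases eq_or_ne (h.toPW f : ℂ → ℂ) 0 with hf0 | hf0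
    · simp [hf0, nuNormSq]
    · exact (h.re_nuNormSq_pos (h.toPW f).2 hf0).le
  add_left f g p := nuForm_add_right ν (h.toPW p).2 (h.toPW f).2 (h.toPW g).2
  smul_left f g c := nuForm_smul_right ν c (h.toPW g) (h.toPW f)
  definite f hf := by
    by_contra hf0
    have hpos := h.re_nuNormSq_pos (h.toPW f).2 fun hzero => hf0 (Subtype.ext hzero)
    rw [← nuForm_self, hf] at hpos
    exact lt_irrefl _ hpos

noncomputable instance : NormedAddCommGroup h.Space :=
  h.core.toNormedAddCommGroup

noncomputable instance : InnerProductSpace ℂ h.Space :=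
  InnerProductSpace.ofCore h.core.toCore

theorem inner_eq_nuForm (f g : h.Space) : inner ℂ g f = nuForm ν (h.toPW f) (h.toPW g) :=
  rfl

theorem norm_sq_eq_re_nuNormSq (f : h.Space) : ‖f‖ ^ 2 = (nuNormSq ν (h.toPW f)).re := by
  rw [← inner_self_eq_norm_sq (𝕜 := ℂ), inner_eq_nuForm, nuForm_self, RCLike.re_eq_complex_re]

theorem norm_eq_nuNorm (f : h.Space) : ‖f‖ = nuNorm ν (h.toPW f) := by
  rw [nuNorm, ← norm_sq_eq_re_nuNormSq, Real.sqrt_sq (norm_nonneg f)]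

theorem mul_norm_toL2_le_norm (f : h.Space) : a * ‖toL2 τ (h.toPW f)‖ ≤ ‖f‖ := by
  rw [norm_toL2, norm_eq_nuNorm]
  exact h.lower_le _ (h.toPW f).2

theorem norm_le_mul_norm_toL2 (f : h.Space) : ‖f‖ ≤ b * ‖toL2 τ (h.toPW f)‖ := by
  rw [norm_toL2, norm_eq_nuNorm]
  exact h.le_upper _ (h.toPW f).2

noncomputable instance : CompleteSpace h.Space := by
  let ι : h.Space →ₗ[ℂ] Lp ℂ 2 (volume : Measure ℝ) := toL2 τ ∘ₗ h.toPW
  have hlip : UniformContinuous ι :=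
    (AddMonoidHomClass.lipschitz_of_bound ι a⁻¹ fun f =>
      (le_inv_mul_iff₀ h.lower_pos).2 (h.mul_norm_toL2_le_norm f)).uniformContinuous
  have hanti : AntilipschitzWith b.toNNReal ι :=
    AddMonoidHomClass.antilipschitz_of_bound ι fun f => (h.norm_le_mul_norm_toL2 f).trans
      (mul_le_mul_of_nonneg_right (Real.le_coe_toNNReal b) (norm_nonneg _))
  have hrange : Set.range ι = Set.range (toL2 τ) := h.toPW.surjective.range_comp (toL2 τ)
  rw [completeSpace_iff_isComplete_range (hanti.isUniformInducing hlip), hrange]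
  exact (isClosed_range_toL2 h.type_nonneg).isComplete

theorem continuous_apply (z : ℂ) : Continuous fun f : h.Space => (h.toPW f : ℂ → ℂ) z := by
  have hτ := h.type_nonneg
  obtain ⟨B, hB, hle⟩ := exists_norm_apply_le_mul_norm_toL2 (add_nonneg hτ zero_le_one)
    (lt_add_one τ)
  let ev : h.Space →ₗ[ℂ] ℂ := LinearMap.proj z ∘ₗ (PWSubmodule τ).subtype ∘ₗ h.toPW
  refine AddMonoidHomClass.continuous_of_bound ev (B * a⁻¹ * Real.exp ((τ + 1) * |z.im|))
    fun f => (hle (h.toPW f) z).trans ?_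
  have hnorm := (le_inv_mul_iff₀ h.lower_pos).2 (h.mul_norm_toL2_le_norm f)
  calc B * ‖toL2 τ (h.toPW f)‖ * Real.exp ((τ + 1) * |z.im|)
      ≤ B * (a⁻¹ * ‖f‖) * Real.exp ((τ + 1) * |z.im|) := by gcongr
    _ = B * a⁻¹ * Real.exp ((τ + 1) * |z.im|) * ‖f‖ := by ring

noncomputable instance : RKHS ℂ h.Space ℂ ℂ where
  coeCLM := ⟨(PWSubmodule τ).subtype ∘ₗ h.toPW, continuous_pi h.continuous_apply⟩
  coeCLM_injective := Subtype.val_injective.comp h.toPW.injective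

theorem range_coe : Set.range (fun f : h.Space => (f : ℂ → ℂ)) = PW τ :=
  (h.toPW.surjective.range_comp Subtype.val).trans Subtype.range_val

end NormEquivalence

section ReproducingKernel

variable (H : Type*) [NormedAddCommGroup H] [InnerProductSpace ℂ H] [CompleteSpace H]
  [RKHS ℂ H ℂ ℂ]

theorem reproducingKernel_self (w : ℂ) :
    reproducingKernel H w w = ((‖RKHS.kerFun H w (1 : ℂ)‖ ^ 2 : ℝ) : ℂ) := by
  have hrepr := RKHS.kerFun_inner w (1 : ℂ) (RKHS.kerFun H w (1 : ℂ))
  rw [inner_self_eq_norm_sq_to_K] at hrepr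
  simpa [reproducingKernel] using hrepr.symm

variable {H}

theorem kerFun_ne_zero {f : H} {w : ℂ} (hf : f w ≠ 0) : RKHS.kerFun H w (1 : ℂ) ≠ 0 := by
  intro hzero
  have hrepr := RKHS.kerFun_inner w (1 : ℂ) f
  rw [hzero, inner_zero_left] at hrepr
  exact hf (by simpa using hrepr.symm)

theorem re_reproducingKernel_self_pos {f : H} {w : ℂ} (hf : f w ≠ 0) :
    0 < (reproducingKernel H w w).re := by
  rw [reproducingKernel_self, Complex.ofReal_re]
  exact pow_pos (norm_pos_iff.2 (kerFun_ne_zero hf)) 2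

end ReproducingKernel

theorem NormEquivalence.re_reproducingKernel_zero_pos {τ a b : ℝ} {ν : Measure ℝ}
    [IsFiniteMeasure ν] (h : NormEquivalence τ ν a b) (hτ : 0 < τ) :
    0 < (reproducingKernel h.Space 0 0).re := by
  obtain ⟨f, hf, hf0⟩ := exists_mem_PW_apply_zero_ne_zero hτ
  exact re_reproducingKernel_self_pos (f := h.toPW.symm ⟨f, hf⟩) hf0

theorem NormEquivalence.extremalConst_le {Δ a b : ℝ} {ν : Measure ℝ} [IsFiniteMeasure ν]
    (h : NormEquivalence (Real.pi * Δ) ν a b) (hΔ : 0 < Δ) (hν : ν (Set.Icc (-Δ) Δ)ᶜ = 0) :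
    extremalConst Δ ν ≤ ((1 / (reproducingKernel h.Space 0 0).re : ℝ) : EReal) := by
  let k : h.Space := RKHS.kerFun h.Space 0 (1 : ℂ)
  have hval : (h.toPW k : ℂ → ℂ) 0 = ((‖k‖ ^ 2 : ℝ) : ℂ) := reproducingKernel_self h.Space 0
  have hre : (reproducingKernel h.Space 0 0).re = ‖k‖ ^ 2 := congrArg Complex.re hval
  have hpos : 0 < ‖k‖ ^ 2 := hre ▸ h.re_reproducingKernel_zero_pos (by positivity)
  have hk0 : (h.toPW k : ℂ → ℂ) 0 ≠ 0 := hval ▸ Complex.ofReal_ne_zero.2 hpos.ne'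
  refine (extremalConst_le_of_mem_PW hΔ.le hν (h.toPW k).2 hk0).trans_eq ?_
  rw [hre, ← h.norm_sq_eq_re_nuNormSq, hval, Complex.norm_real, Real.norm_of_nonneg hpos.le,
    sq (‖k‖ ^ 2), div_mul_cancel_left₀ hpos.ne', one_div]

end PaleyWiener

theorem mainTheorem8 (Δ : ℝ) (hΔ : 0 < Δ)
    (ν : MeasureTheory.Measure ℝ) [MeasureTheory.IsFiniteMeasure ν]
    (hν : ν (Set.Icc (-Δ) Δ)ᶜ = 0)
    (a b : ℝ) (ha : 0 < a) (hb : 0 < b)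
    (hnorm : ∀ f ∈ PaleyWiener.PW (Real.pi * Δ),
      (PaleyWiener.nuNormSq ν f).im = 0 ∧
      a * PaleyWiener.l2Norm f ≤ PaleyWiener.nuNorm ν f ∧
      PaleyWiener.nuNorm ν f ≤ b * PaleyWiener.l2Norm f) :
    PaleyWiener.nuSpace Δ ν = PaleyWiener.PW (Real.pi * Δ) ∧
    ∃ (H : Type) (_ : NormedAddCommGroup H) (_ : InnerProductSpace ℂ H) (_ : CompleteSpace H)
      (_ : RKHS ℂ H ℂ ℂ),
      Set.range (fun f : H => (f : ℂ → ℂ)) = PaleyWiener.nuSpace Δ ν ∧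
      (∀ f g : H, inner ℂ g f = PaleyWiener.nuForm ν f g) ∧
      (∀ f : H, ‖f‖ = PaleyWiener.nuNorm ν f) ∧
      (PaleyWiener.reproducingKernel H 0 0).im = 0 ∧
      0 < (PaleyWiener.reproducingKernel H 0 0).re ∧
      PaleyWiener.extremalConst Δ ν ≤
        ((1 / (PaleyWiener.reproducingKernel H 0 0).re : ℝ) : EReal) := by
  have hτ : 0 < Real.pi * Δ := mul_pos Real.pi_pos hΔ
  have hspace : PaleyWiener.nuSpace Δ ν = PaleyWiener.PW (Real.pi * Δ) :=
    PaleyWiener.nuSpace_eq_PW hΔ ha fun f hf => (hnorm f hf).2.1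
  have hequiv : PaleyWiener.NormEquivalence (Real.pi * Δ) ν a b :=
    ⟨hτ.le, ha, fun f hf => (hnorm f hf).1, fun f hf => (hnorm f hf).2.1,
      fun f hf => (hnorm f hf).2.2⟩
  refine ⟨hspace, hequiv.Space, inferInstance, inferInstance, inferInstance, inferInstance,
    hequiv.range_coe.trans hspace.symm, hequiv.inner_eq_nuForm, hequiv.norm_eq_nuNorm, ?_,
    hequiv.re_reproducingKernel_zero_pos hτ, hequiv.extremalConst_le hΔ hν⟩
  rw [PaleyWiener.reproducingKernel_self, Complex.ofReal_im]
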